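/- Let $n\ge 2$, let $S^{n-1}$ be the unit sphere of $\mathbb R^n$ with surface measure $\mathcal H^{n-1}$, and let $SH^k$ be the space of real spherical harmonics of degree $k\ge 0$ (the restrictions to $S^{n-1}$ of the harmonic homogeneous polynomials of degree $k$). For every $k$ let $\{Y_{k,l}:1\le l\le d_k\}$ be an orthonormal basis of $SH^k$ in $L^2(S^{n-1})$, and let $$P_ku(x)=\sum_{l=1}^{d_k}\Big(\int_{S^{n-1}}u\,Y_{k,l}\,d\mathcal H^{n-1}\Big)Y_{k,l}(x)$$ be the orthogonal projection onto $SH^k$. For $u\in C^\infty(S^{n-1})$ real-valued, $t\ge 0$ and $0<s<1$, define $$(-\Delta_{S^{n-1}})^su=\sum_{k=0}^\infty (k(k+n-2))^s\,P_ku,\qquad \big(L+\tfrac{n-2}{2}\big)^{2s}u=\sum_{k=0}^\infty\big(k+\tfrac{n-2}{2}\big)^{2s}P_ku,\qquad e^{-tL}u=\sum_{k=0}^\infty e^{-tk}P_ku,$$ where $Lu=\sum_{k=0}^\infty k\,P_ku$ is the Dirichlet-to-Neumann operator of the unit ball and $e^{-tL}$ is its Poisson semigroup. For real $\rho$ let $$\mathcal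 B_\rho(z)=\mathcal I_\rho(z)-\frac{(z/2)^\rho}{\Gamma(\rho+1)}=\sum_{m=1}^\infty\frac{(z/2)^{2m+\rho}}{\Gamma(m+1)\Gamma(m+\rho+1)},\qquad \mathcal I_\rho(z)=\sum_{m=0}^\infty\frac{(z/2)^{2m+\rho}}{\Gamma(m+1)\Gamma(m+\rho+1)},$$ with $1/\Gamma=0$ at the poles of $\Gamma$ (at $z=0$, $\mathcal B_\rho$ is given by the second series). Theorem. Let $0<s<1$ and let $u$ be a smooth real function on $S^{n-1}$. For every $x\in S^{n-1}$ the three series above converge absolutely (the third for every $t\ge 0$), the integral below converges absolutely, and $$(-\Delta_{S^{n-1}})^su(x)=\big(L+\tfrac{n-2}{2}\big)^{2s}u(x)+S^su(x),$$ where $$S^su(x)=\frac{(n-2)^{s+1/2}}{\pi^{-1/2}\,\Gamma(-s)}\int_0^\infty e^{-t\frac{n-2}{2}}\,e^{-tL}u(x)\,\mathcal B_{-s-1/2}\big(\tfrac{n-2}{2}t\big)\,\frac{dt}{t^{1/2+s}}.$$ -/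

import Mathlib

open MeasureTheory Set
open scoped ContDiff

namespace SphereFrac

noncomputable section

/-- The unit sphere `S^{n-1} = {X ∈ ℝⁿ : |X| = 1}`. -/
abbrev UnitSphere (n : ℕ) : Type := Metric.sphere (0 : EuclideanSpace ℝ (Fin n)) 1

/-- The surface measure of `S^{n-1}`, that is, the `(n-1)`-dimensional Hausdorff measure with the
usual normalization (total mass `2 π^{n/2} / Γ(n/2)`). -/
def surfaceMeasure (n : ℕ) : Measure (UnitSphere n) :=
  (volume : Measure (EuclideanSpace ℝ (Fin n))).toSphere

/-- The extension `X ↦ u (X / |X|)` of `u`, constant along the normal lines of the sphere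
(with the irrelevant value `0` at the origin). -/
def normalExtension {n : ℕ} (u : UnitSphere n → ℝ) (X : EuclideanSpace ℝ (Fin n)) : ℝ :=
  if h : X = 0 then 0
  else u ⟨‖X‖⁻¹ • X, by
    rw [mem_sphere_zero_iff_norm, norm_smul, norm_inv, norm_norm,
      inv_mul_cancel₀ (norm_ne_zero_iff.mpr h)]⟩

/-- `u ∈ C^∞(S^{n-1})`: the normal extension of `u` is smooth in a neighbourhood of the sphere. -/
def IsSmooth {n : ℕ} (u : UnitSphere n → ℝ) : Prop :=
  ∃ U : Set (EuclideanSpace ℝ (Fin n)), IsOpen U ∧ Metric.sphere 0 1 ⊆ U ∧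
    ContDiffOn ℝ ∞ (normalExtension u) U

/-- The Laplacian `∑ᵢ ∂²/∂Xᵢ²` on real polynomials in `n` variables. -/
def polyLaplacian (n : ℕ) : MvPolynomial (Fin n) ℝ →ₗ[ℝ] MvPolynomial (Fin n) ℝ :=
  ∑ i, (MvPolynomial.pderiv i).toLinearMap ∘ₗ (MvPolynomial.pderiv i).toLinearMap

/-- Restriction of a polynomial function on `ℝⁿ` to the unit sphere. -/
def restrictToSphere (n : ℕ) : MvPolynomial (Fin n) ℝ →ₗ[ℝ] (UnitSphere n → ℝ) :=
  (MvPolynomial.aeval fun (i : Fin n) (x : UnitSphere n) => x.1 i).toLinearMap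

/-- The space `SH^k` of real spherical harmonics of degree `k`: the restrictions to the sphere of
the harmonic homogeneous polynomials of degree `k`. -/
def sphericalHarmonics (n k : ℕ) : Submodule ℝ (UnitSphere n → ℝ) :=
  (MvPolynomial.homogeneousSubmodule (Fin n) ℝ k ⊓ LinearMap.ker (polyLaplacian n)).map
    (restrictToSphere n)

/-- For every `k`, the functions `Y_{k,l}`, `l < d k`, are an orthonormal basis of `SH^k` for the
inner product of `L²(S^{n-1})`. -/
structure IsSphericalHarmonicBasis {n : ℕ} {d : ℕ → ℕ}
    (Y : (k : ℕ) → Fin (d k) → UnitSphere n → ℝ) : Prop where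
  orthonormal : ∀ k l l', ∫ y, Y k l y * Y k l' y ∂(surfaceMeasure n) = if l = l' then 1 else 0
  span_eq : ∀ k, Submodule.span ℝ (Set.range (Y k)) = sphericalHarmonics n k

/-- The orthogonal projector `P_k u = ∑_l c_{k,l}(u) Y_{k,l}` of `L²(S^{n-1})` onto `SH^k`, where
`c_{k,l}(u) = ∫ u Y_{k,l}`. -/
def proj {n : ℕ} {d : ℕ → ℕ} (Y : (k : ℕ) → Fin (d k) → UnitSphere n → ℝ)
    (k : ℕ) (u : UnitSphere n → ℝ) (x : UnitSphere n) : ℝ :=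
  ∑ l, (∫ y, u y * Y k l y ∂(surfaceMeasure n)) * Y k l x

/-- The eigenvalue `λ_k = k (k + n - 2)` of `-Δ` on `S^{n-1}`, with eigenspace `SH^k`. -/
def eigenvalue (n k : ℕ) : ℝ := (k : ℝ) * ((k : ℝ) + (n : ℝ) - 2)

/-- The fractional Laplacian on the sphere, `(-Δ)^s u = ∑_k λ_k^s P_k u`. -/
def fracLaplacian {n : ℕ} {d : ℕ → ℕ} (Y : (k : ℕ) → Fin (d k) → UnitSphere n → ℝ)
    (s : ℝ) (u : UnitSphere n → ℝ) (x : UnitSphere n) : ℝ :=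
  ∑' k : ℕ, eigenvalue n k ^ s * proj Y k u x

/-- The function `φ(L)` of the Dirichlet-to-Neumann operator `L u = ∑_k k P_k u` of the unit ball,
`φ(L) u = ∑_k φ(k) P_k u`; the operator `L` itself is the case `φ(r) = r`. -/
def dirichletToNeumannFun {n : ℕ} {d : ℕ → ℕ} (Y : (k : ℕ) → Fin (d k) → UnitSphere n → ℝ)
    (φ : ℝ → ℝ) (u : UnitSphere n → ℝ) (x : UnitSphere n) : ℝ :=
  ∑' k : ℕ, φ k * proj Y k u x

/-- The fractional Dirichlet-to-Neumann operator
`(L + (n-2)/2)^σ u = ∑_k (k + (n-2)/2)^σ P_k u`. -/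
def fracDirichletToNeumann {n : ℕ} {d : ℕ → ℕ} (Y : (k : ℕ) → Fin (d k) → UnitSphere n → ℝ)
    (σ : ℝ) : (UnitSphere n → ℝ) → UnitSphere n → ℝ :=
  dirichletToNeumannFun Y fun r => (r + ((n : ℝ) - 2) / 2) ^ σ

/-- The Poisson semigroup `e^{-tL} u = ∑_k e^{-tk} P_k u`. -/
def poissonSemigroup {n : ℕ} {d : ℕ → ℕ} (Y : (k : ℕ) → Fin (d k) → UnitSphere n → ℝ)
    (t : ℝ) : (UnitSphere n → ℝ) → UnitSphere n → ℝ :=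
  dirichletToNeumannFun Y fun r => Real.exp (-t * r)

/-- The modified Bessel function of the first kind `I_ρ(z)`, for real `ρ` and `z > 0`
(`1 / Γ` is read as `0` at the poles of `Γ`, which is Mathlib's value too). -/
def besselI (ρ z : ℝ) : ℝ :=
  ∑' m : ℕ, (z / 2) ^ (2 * (m : ℝ) + ρ) / (Real.Gamma ((m : ℝ) + 1) * Real.Gamma ((m : ℝ) + ρ + 1))

/-- The truncated Bessel function `B_ρ(z) = I_ρ(z) - (z/2)^ρ / Γ(ρ+1)`, that is, the series of
`I_ρ` without its first term. For `-3/2 < ρ < -1/2` the powers of `0` that enter at `z = 0` are `0`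
in Mathlib, so that `B_ρ(0) = 0`, as for the truncated series. -/
def truncatedBesselI (ρ z : ℝ) : ℝ :=
  besselI ρ z - (z / 2) ^ ρ / Real.Gamma (ρ + 1)

/-- The integrand
`e^{-t(n-2)/2} e^{-tL}u(x) B_{-s-1/2}((n-2)t/2) t^{-1/2-s}` in the definition of `S^s u(x)`. -/
def remainderIntegrand {n : ℕ} {d : ℕ → ℕ} (Y : (k : ℕ) → Fin (d k) → UnitSphere n → ℝ)
    (s : ℝ) (u : UnitSphere n → ℝ) (x : UnitSphere n) (t : ℝ) : ℝ :=
  Real.exp (-t * (((n : ℝ) - 2) / 2)) * poissonSemigroup Y t u x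
    * truncatedBesselI (-s - 1 / 2) (((n : ℝ) - 2) / 2 * t) / t ^ (1 / 2 + s)

/-- The operator `S^s`. -/
def remainderOperator {n : ℕ} {d : ℕ → ℕ} (Y : (k : ℕ) → Fin (d k) → UnitSphere n → ℝ)
    (s : ℝ) (u : UnitSphere n → ℝ) (x : UnitSphere n) : ℝ :=
  ((n : ℝ) - 2) ^ (s + 1 / 2) / (Real.pi ^ (-(1 / 2) : ℝ) * Real.Gamma (-s))
    * ∫ t in Ioi (0 : ℝ), remainderIntegrand Y s u x t

end

end SphereFrac

namespace SphereFrac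

open Filter Topology

/-! Put `a = (n-2)/2` and `μ = k + a`. Since `k (k + n - 2) = μ² - a²`, the formula on `SH^k` is a
scalar identity for `(μ² - a²)^s - μ^{2s} = -μ^{2s} (1 - (1 - a²/μ²)^s)`. The binomial series of `1
- (1 - x)^s` has nonnegative coefficients. Each resulting power `μ^{2s - 2(m+1)}` is a Gamma
integral against `e^{-μt}`, and Legendre's duplication formula identifies the coefficients with
those of the truncated Bessel series. As all terms have one sign, sum and integral may be exchanged
(`kernel_integral`).

Since `e^{-μt} = e^{-at} e^{-kt}`, summation over `k` produces the Poisson semigroup. The kernel is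
nonnegative, so the scalar identity also computes the `L¹` norms, and the exchange only requires `∑
(1 + k²) |P_k u(x)| < ∞` (`representation_of_summable`). For `n = 2` the kernel vanishes and both
multipliers equal `k^{2s}`.

The decay (`summable_proj`) comes from writing `P_k u(x)` as the integral of `u` against the zonal
harmonic, a harmonic homogeneous polynomial `p` with `∫ p² = p(x)`. The mean value property on a
ball of radius `1/(k+1)` bounds `p` by a power of `k + 1` (`exists_sq_polyFun_le`). The operator `∑
(X_i ∂_j - X_j ∂_i)²` is symmetric and multiplies `p` by `-2 λ_k`. Moving its powers onto a smooth
extension of `u` gains arbitrary powers of `λ_k` (`exists_eigenvalue_pow_mul_integral_le`). Both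
estimates are made in `ℝⁿ` with Lebesgue measure and brought to the sphere by polar coordinates. -/

/-- A series of integrable functions with summable `L¹` norms is integrable. -/
theorem integrable_tsum_of_summable_integral_norm {α : Type*} [MeasurableSpace α] {μ : Measure α}
    {F : ℕ → α → ℝ} (hF : ∀ i, Integrable (F i) μ)
    (hS : Summable fun i => ∫ a, ‖F i a‖ ∂μ) :
    Integrable (fun a => ∑' i, F i a) μ := by
  have hI (i : ℕ) : ∫⁻ a, ‖F i a‖ₑ ∂μ = ENNReal.ofReal (∫ a, ‖F i a‖ ∂μ) := by
    rw [ofReal_integral_eq_lintegral_ofReal (hF i).norm (ae_of_all _ fun a => norm_nonneg _)]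
    simp_rw [ofReal_norm]
  have hfin : ∫⁻ a, ∑' i, ‖F i a‖ₑ ∂μ ≠ ⊤ := by
    rw [lintegral_tsum fun i => (hF i).1.enorm]
    simp_rw [hI]
    rw [← ENNReal.ofReal_tsum_of_nonneg (fun i => integral_nonneg fun a => norm_nonneg _) hS]
    exact ENNReal.ofReal_ne_top
  have hae : ∀ᵐ a ∂μ, ∑' i, ‖F i a‖ₑ < ⊤ :=
    ae_lt_top' (AEMeasurable.tsum fun i => (hF i).1.enorm) hfin
  have hsum : ∀ᵐ a ∂μ, Summable fun i => F i a := by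
    filter_upwards [hae] with a ha
    have h : Summable fun i => ‖F i a‖₊ := ENNReal.tsum_coe_ne_top_iff_summable.1 ha.ne
    exact Summable.of_norm (NNReal.summable_coe.2 h)
  refine ⟨aestronglyMeasurable_of_tendsto_ae (atTop : Filter ℕ)
    (f := fun N a => ∑ i ∈ Finset.range N, F i a) (fun N => ?_) ?_, ?_⟩
  · exact Finset.aestronglyMeasurable_fun_sum _ fun i _ => (hF i).1
  · filter_upwards [hsum] with a ha using ha.hasSum.tendsto_sum_nat
  · rw [hasFiniteIntegral_iff_enorm]
    refine lt_of_le_of_lt (lintegral_mono_ae ?_) hfin.lt_top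
    filter_upwards [hae] with a ha
    exact enorm_tsum_le_tsum_enorm

/-! ### The binomial series of `1 - (1 - x)^s` up to the endpoint -/

/-- The coefficients of `(1 - x) ^ s`, in terms of the Gamma function. -/
theorem choose_neg_eq_Gamma_div {s : ℝ} (hs0 : 0 < s) (hs1 : s < 1) (m : ℕ) :
    Ring.choose (-s + m - 1) m = Real.Gamma (m - s) / (Real.Gamma (-s) * m.factorial) := by
  have hG : Real.Gamma (-s) ≠ 0 := Real.Gamma_ne_zero fun k hk => by
    have h1 : s = k := by linarith
    rcases Nat.eq_zero_or_pos k with rfl | hk'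
    · simp at h1; linarith
    · have : (1 : ℝ) ≤ k := by exact_mod_cast hk'
      linarith
  have key : ∀ m : ℕ, Real.Gamma (m - s) = (ascPochhammer ℝ m).eval (-s) * Real.Gamma (-s) := by
    intro m
    induction m with
    | zero => simp
    | succ m ih =>
      have : (m : ℝ) - s ≠ 0 := by
        rcases Nat.eq_zero_or_pos m with rfl | hk'
        · simp; exact hs0.ne'
        · have : (1 : ℝ) ≤ m := by exact_mod_cast hk'
          linarith
      rw [ascPochhammer_succ_eval, show ((m + 1 : ℕ) : ℝ) - s = (m - s) + 1 by push_cast; ring,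
        Real.Gamma_add_one this, ih]
      ring
  have h := Ring.factorial_nsmul_multichoose_eq_ascPochhammer (-s) m
  rw [Ring.multichoose_eq, Polynomial.ascPochhammer_smeval_eq_eval, nsmul_eq_mul] at h
  have hf : (m.factorial : ℝ) ≠ 0 := by positivity
  rw [key, ← h]
  field_simp

/-- The coefficients of `1 - (1 - x) ^ s`; they are nonnegative. -/
noncomputable def binomCoeff (s : ℝ) (m : ℕ) : ℝ :=
  -(Real.Gamma ((m + 1 : ℕ) - s) / (Real.Gamma (-s) * (m + 1).factorial))

theorem Gamma_neg_lt_zero {s : ℝ} (hs0 : 0 < s) (hs1 : s < 1) : Real.Gamma (-s) < 0 := by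
  have h := Real.Gamma_add_one (s := -s) (by linarith)
  have h2 : 0 < Real.Gamma (-s + 1) := Real.Gamma_pos_of_pos (by linarith)
  rw [h] at h2
  nlinarith

theorem binomCoeff_nonneg {s : ℝ} (hs0 : 0 < s) (hs1 : s < 1) (m : ℕ) : 0 ≤ binomCoeff s m := by
  have h1 : 0 < Real.Gamma ((m + 1 : ℕ) - s) := by
    apply Real.Gamma_pos_of_pos
    push_cast
    have : (0 : ℝ) ≤ m := m.cast_nonneg
    linarith
  have h2 := Gamma_neg_lt_zero hs0 hs1
  have hf : (0 : ℝ) < (m + 1).factorial := by positivity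
  rw [binomCoeff, neg_nonneg]
  exact div_nonpos_of_nonneg_of_nonpos h1.le (mul_nonpos_of_nonpos_of_nonneg h2.le hf.le)

/-- This is the power series of `1 / (1 - x)^r` at `r = -s`, with its constant term removed and its
sign reversed. -/
theorem hasSum_binomCoeff_of_lt {s : ℝ} (hs0 : 0 < s) (hs1 : s < 1) {x : ℝ} (hx0 : 0 ≤ x)
    (hx1 : x < 1) : HasSum (fun m => binomCoeff s m * x ^ (m + 1)) (1 - (1 - x) ^ s) := by
  have h := (Real.one_div_one_sub_rpow_hasFPowerSeriesOnBall_zero (-s)).hasSum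
    (y := x) (by simpa [enorm_eq_nnnorm, ← NNReal.coe_lt_coe, abs_of_nonneg hx0] using hx1)
  rw [← hasSum_nat_add_iff' 1] at h
  have e1 (m : ℕ) : binomCoeff s m * x ^ (m + 1) =
      -(FormalMultilinearSeries.ofScalars ℝ (fun n => Ring.choose (-s + ↑n - 1) n) (m + 1))
        fun _ => x := by
    simp only [FormalMultilinearSeries.ofScalars_apply_eq, choose_neg_eq_Gamma_div hs0 hs1,
      binomCoeff, smul_eq_mul]
    ring
  have e2 : 1 - (1 - x) ^ s = -(1 / (1 - (0 + x)) ^ (-s) - ∑ i ∈ Finset.range 1,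
      (FormalMultilinearSeries.ofScalars ℝ (fun n => Ring.choose (-s + ↑n - 1) n) i)
        fun _ => x) := by
    simp [Real.rpow_neg (by linarith : 0 ≤ 1 - x)]
  simp_rw [e1]
  rw [e2]
  exact h.neg

/-- The endpoint `x = 1` is the case `μ = a`, that is `k = 0`. The partial sums of the nonnegative
coefficients are limits of partial sums at `y < 1`, hence at most `1`. The series then converges
uniformly on `[0, 1]`, and the identity extends by continuity. -/
theorem hasSum_binomCoeff {s : ℝ} (hs0 : 0 < s) (hs1 : s < 1) {x : ℝ} (hx0 : 0 ≤ x)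
    (hx1 : x ≤ 1) : HasSum (fun m => binomCoeff s m * x ^ (m + 1)) (1 - (1 - x) ^ s) := by
  have hc := binomCoeff_nonneg hs0 hs1
  have hsum : Summable (binomCoeff s) := by
    refine summable_of_sum_range_le (c := 1) hc fun N => ?_
    have ht : Tendsto (fun x : ℝ => ∑ m ∈ Finset.range N, binomCoeff s m * x ^ (m + 1))
        (𝓝[<] 1) (𝓝 (∑ m ∈ Finset.range N, binomCoeff s m * 1 ^ (m + 1))) := by
      apply Tendsto.mono_left _ nhdsWithin_le_nhds
      apply Continuous.tendsto
      fun_prop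
    simp only [one_pow, mul_one] at ht
    refine le_of_tendsto ht ?_
    filter_upwards [Ioo_mem_nhdsLT (zero_lt_one' ℝ)] with y hy
    have h := hasSum_binomCoeff_of_lt hs0 hs1 hy.1.le hy.2
    calc _ ≤ _ := sum_le_hasSum _ (fun i _ => mul_nonneg (hc i) (pow_nonneg hy.1.le _)) h
      _ ≤ 1 := by linarith [Real.rpow_nonneg (by linarith [hy.2] : 0 ≤ 1 - y) s]
  have hle : ∀ m, ∀ y ∈ Icc (0 : ℝ) 1, ‖binomCoeff s m * y ^ (m + 1)‖ ≤ binomCoeff s m := by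
    intro m y hy
    rw [Real.norm_of_nonneg (mul_nonneg (hc m) (pow_nonneg hy.1 _))]
    exact mul_le_of_le_one_right (hc m) (pow_le_one₀ hy.1 hy.2)
  have hcont : ContinuousOn (fun y : ℝ => ∑' m, binomCoeff s m * y ^ (m + 1)) (Icc 0 1) :=
    continuousOn_tsum (fun m => by fun_prop) hsum hle
  have heq : EqOn (fun y : ℝ => ∑' m, binomCoeff s m * y ^ (m + 1)) (fun y => 1 - (1 - y) ^ s)
      (Icc 0 1) := by
    have hc2 : ContinuousOn (fun y : ℝ => 1 - (1 - y) ^ s) (Icc 0 1) :=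
      (continuous_const.sub ((continuous_const.sub continuous_id).rpow_const
        fun _ => Or.inr hs0.le)).continuousOn
    refine EqOn.of_subset_closure (s := Ico 0 1) (fun y hy => ?_) hcont hc2
      Ico_subset_Icc_self (by rw [closure_Ico (by norm_num)])
    exact (hasSum_binomCoeff_of_lt hs0 hs1 hy.1 hy.2).tsum_eq
  have := heq ⟨hx0, hx1⟩
  simp only at this
  rw [← this]
  exact (Summable.of_norm_bounded hsum fun m => hle m x ⟨hx0, hx1⟩).hasSum

/-! ### The Bessel kernel and its integral -/

/-- Ratio test. For `ρ > -3/2` every term with `m ≥ 1` is positive; the term `m = 0` may be negative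
or zero and is irrelevant to the limit. -/
theorem summable_besselI {ρ z : ℝ} (hρ : -(3 / 2) < ρ) (hz : 0 < z) :
    Summable fun m : ℕ => (z / 2) ^ (2 * (m : ℝ) + ρ) /
      (Real.Gamma ((m : ℝ) + 1) * Real.Gamma ((m : ℝ) + ρ + 1)) := by
  have hz2 : 0 < z / 2 := by positivity
  have hpos (m : ℕ) (hm : 1 ≤ m) : 0 < (z / 2) ^ (2 * (m : ℝ) + ρ) /
      (Real.Gamma ((m : ℝ) + 1) * Real.Gamma ((m : ℝ) + ρ + 1)) := by
    have h1 : (1 : ℝ) ≤ m := by exact_mod_cast hm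
    have h2 : 0 < Real.Gamma ((m : ℝ) + ρ + 1) := Real.Gamma_pos_of_pos (by linarith)
    positivity
  refine summable_of_ratio_test_tendsto_lt_one zero_lt_one
    ((eventually_ge_atTop 1).mono fun m hm => (hpos m hm).ne') ?_
  have hlim : Tendsto (fun m : ℕ => (z / 2) ^ 2 * ((((m : ℝ) + 1))⁻¹ * ((m : ℝ) + (ρ + 1))⁻¹)) atTop
      (𝓝 ((z / 2) ^ 2 * (0 * 0))) := by
    refine Tendsto.const_mul _ (Tendsto.mul ?_ ?_)
    · exact tendsto_inv_atTop_zero.comp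
        (tendsto_atTop_add_const_right _ _ tendsto_natCast_atTop_atTop)
    · exact tendsto_inv_atTop_zero.comp
        (tendsto_atTop_add_const_right _ _ tendsto_natCast_atTop_atTop)
  simp only [mul_zero] at hlim
  refine hlim.congr' ?_
  filter_upwards [eventually_ge_atTop 1] with m hm
  rw [Real.norm_of_nonneg (hpos m hm).le, Real.norm_of_nonneg (hpos (m + 1) (by omega)).le]
  have h1 : (1 : ℝ) ≤ m := by exact_mod_cast hm
  have h2 : 0 < Real.Gamma ((m : ℝ) + ρ + 1) := Real.Gamma_pos_of_pos (by linarith)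
  have h3 : 0 < Real.Gamma ((m : ℝ) + 1) := Real.Gamma_pos_of_pos (by linarith)
  have h4 : 0 < (m : ℝ) + ρ + 1 := by linarith
  have h5 : 0 < (z / 2) ^ (2 * (m : ℝ) + ρ) := by positivity
  push_cast
  rw [show (m : ℝ) + 1 + ρ + 1 = (m + ρ + 1) + 1 by ring, Real.Gamma_add_one h4.ne',
    Real.Gamma_add_one (by linarith : (m : ℝ) + 1 ≠ 0),
    show 2 * ((m : ℝ) + 1) + ρ = 2 * m + ρ + 2 by ring, Real.rpow_add hz2, Real.rpow_two,
    show (m : ℝ) + (ρ + 1) = m + ρ + 1 by ring]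
  field_simp

/-- The subtracted term is exactly the one at `m = 0`. This includes `ρ = -1` (`s = 1/2`), where
both are divisions by `Γ(0) = 0` and have value `0`. -/
theorem truncatedBesselI_eq_tsum {ρ z : ℝ} (hρ : -(3 / 2) < ρ) (hz : 0 < z) :
    truncatedBesselI ρ z = ∑' m : ℕ, (z / 2) ^ (2 * ((m : ℝ) + 1) + ρ) /
      (Real.Gamma ((m : ℝ) + 1 + 1) * Real.Gamma ((m : ℝ) + 1 + ρ + 1)) := by
  rw [truncatedBesselI, besselI, (summable_besselI hρ hz).tsum_eq_zero_add]
  simp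

/-- The `m`-th term of the series of the kernel `e^{-tμ} B_{-s-1/2}(at) t^{-1/2-s}`. -/
noncomputable def kernelTerm (a μ s : ℝ) (m : ℕ) (t : ℝ) : ℝ :=
  Real.exp (-t * μ) * ((a * t / 2) ^ (2 * ((m : ℝ) + 1) + (-s - 1 / 2)) /
      (Real.Gamma ((m : ℝ) + 1 + 1) * Real.Gamma ((m : ℝ) + 1 + (-s - 1 / 2) + 1))) /
      t ^ (1 / 2 + s)

/-- The constant in front of the integral in the definition of `S^s`. -/
noncomputable def remainderConst (a s : ℝ) : ℝ :=
  (2 * a) ^ (s + 1 / 2) / (Real.pi ^ (-(1 / 2) : ℝ) * Real.Gamma (-s))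

theorem remainderConst_neg {a s : ℝ} (ha : 0 < a) (hs0 : 0 < s) (hs1 : s < 1) :
    remainderConst a s < 0 := by
  have := Gamma_neg_lt_zero hs0 hs1
  exact div_neg_of_pos_of_neg (by positivity) (mul_neg_of_pos_of_neg (by positivity) this)

theorem kernelTerm_nonneg {a μ s : ℝ} (ha : 0 < a) (hs1 : s < 1) (m : ℕ) {t : ℝ} (ht : 0 < t) :
    0 ≤ kernelTerm a μ s m t := by
  have h0 : (0 : ℝ) ≤ m := m.cast_nonneg
  have : 0 < Real.Gamma ((m : ℝ) + 1 + (-s - 1 / 2) + 1) := Real.Gamma_pos_of_pos (by linarith)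
  unfold kernelTerm
  positivity

/-- Collecting the powers of `t` exhibits a Gamma integrand of exponent `2(m+1) - 2s`, positive
because `s < 1`. The omitted first Bessel term would give the divergent exponent `-2s`. -/
theorem kernelTerm_eq {a μ s : ℝ} (ha : 0 < a) (m : ℕ) {t : ℝ} (ht : 0 < t) :
    kernelTerm a μ s m t = (a / 2) ^ (2 * ((m : ℝ) + 1) + (-s - 1 / 2)) /
      (Real.Gamma ((m : ℝ) + 1 + 1) * Real.Gamma ((m : ℝ) + 1 + (-s - 1 / 2) + 1)) *
      (t ^ ((2 * ((m : ℝ) + 1) - 2 * s) - 1) * Real.exp (-(μ * t))) := by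
  have h : t ^ ((2 * ((m : ℝ) + 1) - 2 * s) - 1) =
      t ^ (2 * ((m : ℝ) + 1) + (-s - 1 / 2)) / t ^ (1 / 2 + s) := by
    rw [← Real.rpow_sub ht]
    congr 1
    ring
  rw [kernelTerm, h, show a * t / 2 = a / 2 * t by ring,
    Real.mul_rpow (by positivity) ht.le, show -t * μ = -(μ * t) by ring]
  ring

theorem integrableOn_kernelTerm {a μ s : ℝ} (ha : 0 < a) (hμ : 0 < μ) (hs1 : s < 1) (m : ℕ) :
    IntegrableOn (kernelTerm a μ s m) (Ioi 0) := by
  have h0 : (0 : ℝ) ≤ m := m.cast_nonneg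
  have h := integrableOn_rpow_mul_exp_neg_mul_rpow (p := 1) (b := μ)
    (s := (2 * ((m : ℝ) + 1) - 2 * s) - 1) (by linarith) one_pos hμ
  refine IntegrableOn.congr_fun (h.const_mul ((a / 2) ^ (2 * ((m : ℝ) + 1) + (-s - 1 / 2)) /
      (Real.Gamma ((m : ℝ) + 1 + 1) * Real.Gamma ((m : ℝ) + 1 + (-s - 1 / 2) + 1))))
    (fun t ht => ?_) measurableSet_Ioi
  rw [kernelTerm_eq ha m ht, Real.rpow_one, neg_mul]

/-- The Gamma integral produces `Γ(2z)` with `z = m + 1 - s`. By duplication it splits into `Γ(z)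
Γ(z + 1/2)`: the second factor cancels the Bessel denominator, the first is the numerator of the
binomial coefficient. -/
theorem integral_kernelTerm {a μ s : ℝ} (ha : 0 < a) (hμ : 0 < μ) (hs1 : s < 1) (m : ℕ) :
    remainderConst a s * ∫ t in Ioi (0 : ℝ), kernelTerm a μ s m t =
      -(μ ^ (2 * s) * (binomCoeff s m * (a ^ 2 / μ ^ 2) ^ (m + 1))) := by
  have h0 : (0 : ℝ) ≤ m := m.cast_nonneg
  rw [setIntegral_congr_fun measurableSet_Ioi fun t ht => kernelTerm_eq ha m ht,
    integral_const_mul, Real.integral_rpow_mul_exp_neg_mul_Ioi (by linarith) hμ]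
  have hdup := Real.Gamma_mul_Gamma_add_half ((m : ℝ) + 1 - s)
  rw [show 2 * ((m : ℝ) + 1 - s) = 2 * ((m : ℝ) + 1) - 2 * s by ring] at hdup
  have hG : 0 < Real.Gamma ((m : ℝ) + 1 - s + 1 / 2) := Real.Gamma_pos_of_pos (by linarith)
  -- The surplus power of `2` is precisely the factor `2^{1-2z}` of the duplication formula;
  -- comparing logarithms checks the powers of `2`, `a` and `μ` at once.
  have hpow : (2 * a) ^ (s + 1 / 2) * (a / 2) ^ (2 * ((m : ℝ) + 1) + (-s - 1 / 2)) *
      (1 / μ) ^ (2 * ((m : ℝ) + 1) - 2 * s) =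
      2 ^ (1 - (2 * ((m : ℝ) + 1) - 2 * s)) * (μ ^ (2 * s) * (a ^ 2 / μ ^ 2) ^ (m + 1)) := by
    rw [← Real.rpow_natCast (a ^ 2 / μ ^ 2)]
    simp only [Real.rpow_def_of_pos hμ,
      Real.rpow_def_of_pos (show 0 < 2 * a by positivity),
      Real.rpow_def_of_pos (show 0 < a / 2 by positivity),
      Real.rpow_def_of_pos (show 0 < 1 / μ by positivity),
      Real.rpow_def_of_pos (show (0 : ℝ) < 2 by positivity),
      Real.rpow_def_of_pos (show 0 < a ^ 2 / μ ^ 2 by positivity), ← Real.exp_add]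
    rw [Real.log_mul two_ne_zero ha.ne', Real.log_div ha.ne' two_ne_zero,
      Real.log_div one_ne_zero hμ.ne', Real.log_div (by positivity) (by positivity),
      Real.log_pow, Real.log_pow, Real.log_one]
    congr 1
    push_cast
    ring
  have hpi : Real.pi ^ (-(1 / 2) : ℝ) = (√Real.pi)⁻¹ := by
    rw [Real.rpow_neg Real.pi_pos.le, Real.sqrt_eq_rpow]
  rw [remainderConst, binomCoeff, hpi, ← Real.Gamma_nat_eq_factorial]
  have hf : 0 < Real.Gamma ((m : ℝ) + 1 + 1) := Real.Gamma_pos_of_pos (by linarith)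
  have hπ : 0 < √Real.pi := Real.sqrt_pos.2 Real.pi_pos
  push_cast
  rw [show (m : ℝ) + 1 + (-s - 1 / 2) + 1 = m + 1 - s + 1 / 2 by ring]
  calc _ = ((2 * a) ^ (s + 1 / 2) * (a / 2) ^ (2 * ((m : ℝ) + 1) + (-s - 1 / 2)) *
      (1 / μ) ^ (2 * ((m : ℝ) + 1) - 2 * s)) * (Real.Gamma (2 * ((m : ℝ) + 1) - 2 * s) *
        √Real.pi / (Real.Gamma (-s) * Real.Gamma ((m : ℝ) + 1 + 1) *
        Real.Gamma ((m : ℝ) + 1 - s + 1 / 2))) := by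
        field_simp
    _ = (μ ^ (2 * s) * (a ^ 2 / μ ^ 2) ^ (m + 1)) * ((Real.Gamma (2 * ((m : ℝ) + 1) - 2 * s) *
        2 ^ (1 - (2 * ((m : ℝ) + 1) - 2 * s)) * √Real.pi) /
        (Real.Gamma (-s) * Real.Gamma ((m : ℝ) + 1 + 1) *
        Real.Gamma ((m : ℝ) + 1 - s + 1 / 2))) := by
        rw [hpow]; ring
    _ = _ := by
        rw [← hdup]
        generalize Real.Gamma ((m : ℝ) + 1 - s + 1 / 2) = G at hG
        field_simp

/-- The kernel `e^{-tμ} B_{-s-1/2}(at) t^{-1/2-s}`. -/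
noncomputable def kernel (a μ s t : ℝ) : ℝ :=
  Real.exp (-t * μ) * truncatedBesselI (-s - 1 / 2) (a * t) / t ^ (1 / 2 + s)

theorem kernel_eq_tsum {a μ s : ℝ} (ha : 0 < a) (hs1 : s < 1) {t : ℝ} (ht : 0 < t) :
    kernel a μ s t = ∑' m, kernelTerm a μ s m t := by
  rw [kernel, truncatedBesselI_eq_tsum (by linarith) (mul_pos ha ht)]
  simp_rw [kernelTerm]
  rw [tsum_div_const, tsum_mul_left]

theorem kernel_nonneg {a μ s : ℝ} (ha : 0 < a) (hs1 : s < 1) {t : ℝ} (ht : 0 < t) :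
    0 ≤ kernel a μ s t := by
  rw [kernel_eq_tsum ha hs1 ht]
  exact tsum_nonneg fun m => kernelTerm_nonneg ha hs1 m ht

/-- The binomial series at `x = a²/μ² ≤ 1` is integrated term by term. The terms are nonnegative, so
convergence of the binomial series is itself the summability of their `L¹` norms. -/
theorem kernel_integral {a μ s : ℝ} (ha : 0 < a) (hμ : a ≤ μ) (hs0 : 0 < s) (hs1 : s < 1) :
    IntegrableOn (kernel a μ s) (Ioi 0) ∧
      remainderConst a s * ∫ t in Ioi (0 : ℝ), kernel a μ s t =
        (μ ^ 2 - a ^ 2) ^ s - μ ^ (2 * s) := by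
  have hμ0 : 0 < μ := ha.trans_le hμ
  have hC := remainderConst_neg ha hs0 hs1
  have hx0 : 0 ≤ a ^ 2 / μ ^ 2 := by positivity
  have hx1 : a ^ 2 / μ ^ 2 ≤ 1 := by
    rw [div_le_one (by positivity)]
    exact pow_le_pow_left₀ ha.le hμ 2
  have hsum := ((hasSum_binomCoeff hs0 hs1 hx0 hx1).mul_left (μ ^ (2 * s))).neg
  simp_rw [← integral_kernelTerm ha hμ0 hs1] at hsum
  have hint (m : ℕ) := integrableOn_kernelTerm ha hμ0 hs1 m
  have hnorm (m : ℕ) : ∫ t in Ioi (0 : ℝ), ‖kernelTerm a μ s m t‖ =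
      ∫ t in Ioi (0 : ℝ), kernelTerm a μ s m t :=
    setIntegral_congr_fun measurableSet_Ioi fun t ht =>
      Real.norm_of_nonneg (kernelTerm_nonneg ha hs1 m ht)
  have hS : Summable fun m => ∫ t in Ioi (0 : ℝ), ‖kernelTerm a μ s m t‖ := by
    simp_rw [hnorm]
    exact (summable_mul_left_iff hC.ne).1 hsum.summable
  have hk : EqOn (fun t => ∑' m, kernelTerm a μ s m t) (kernel a μ s) (Ioi 0) :=
    fun t ht => (kernel_eq_tsum ha hs1 ht).symm
  refine ⟨IntegrableOn.congr_fun (integrable_tsum_of_summable_integral_norm hint hS) hk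
    measurableSet_Ioi, ?_⟩
  rw [← setIntegral_congr_fun measurableSet_Ioi hk,
    ← integral_tsum_of_summable_integral_norm hint hS, ← tsum_mul_left, hsum.tsum_eq]
  have h1 : (μ ^ 2 - a ^ 2) ^ s = μ ^ (2 * s) * (1 - a ^ 2 / μ ^ 2) ^ s := by
    rw [Real.rpow_mul hμ0.le, Real.rpow_two, ← Real.mul_rpow (by positivity) (by linarith)]
    congr 1
    field_simp
  rw [h1]
  ring

/-! ### Summation over the degree, assuming decay of the projections -/

theorem rpow_le_one_add {x s : ℝ} (hx : 0 ≤ x) (hs0 : 0 ≤ s) (hs1 : s ≤ 1) : x ^ s ≤ 1 + x := by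
  rcases le_total x 1 with h | h
  · linarith [Real.rpow_le_one hx h hs0]
  · linarith [Real.rpow_le_self_of_one_le h hs1]

theorem eigenvalue_eq (n k : ℕ) : eigenvalue n k =
    ((k : ℝ) + ((n : ℝ) - 2) / 2) ^ 2 - (((n : ℝ) - 2) / 2) ^ 2 := by
  rw [eigenvalue]; ring

/-- For `n = 2` the Bessel argument is `0`. All exponents `2m - s - 1/2` are nonzero, including the
negative one at `m = 0`, so each power of `0` has value `0`. -/
theorem remainderIntegrand_eq_zero {d : ℕ → ℕ} (Y : (k : ℕ) → Fin (d k) → UnitSphere 2 → ℝ)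
    {s : ℝ} (hs0 : 0 < s) (hs1 : s < 1) (u : UnitSphere 2 → ℝ) (x : UnitSphere 2) (t : ℝ) :
    remainderIntegrand Y s u x t = 0 := by
  have hne (m : ℕ) : 2 * (m : ℝ) + (-s - 1 / 2) ≠ 0 := by
    rcases Nat.eq_zero_or_pos m with rfl | hm
    · simp; linarith
    · have : (1 : ℝ) ≤ m := by exact_mod_cast hm
      linarith
  have hB : truncatedBesselI (-s - 1 / 2) 0 = 0 := by
    simp only [truncatedBesselI, besselI, zero_div, Real.zero_rpow (hne _),
      Real.zero_rpow (show -s - 1 / 2 ≠ 0 by linarith), tsum_zero, sub_zero]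
  have h2 : (((2 : ℕ) : ℝ) - 2) / 2 * t = 0 := by norm_num
  rw [remainderIntegrand, h2, hB]
  simp

/-- The representation formula, given the decay of the projections. -/
theorem representation_of_summable (n : ℕ) (hn : 2 ≤ n) (d : ℕ → ℕ)
    (Y : (k : ℕ) → Fin (d k) → UnitSphere n → ℝ)
    (s : ℝ) (hs0 : 0 < s) (hs1 : s < 1) (u : UnitSphere n → ℝ) (x : UnitSphere n)
    (hp : Summable fun k : ℕ => (1 + (k : ℝ) ^ 2) * |proj Y k u x|) :
    Summable (fun k : ℕ => eigenvalue n k ^ s * proj Y k u x) ∧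
    Summable (fun k : ℕ => ((k : ℝ) + ((n : ℝ) - 2) / 2) ^ (2 * s) * proj Y k u x) ∧
    (∀ t : ℝ, 0 ≤ t → Summable (fun k : ℕ => Real.exp (-t * (k : ℝ)) * proj Y k u x)) ∧
    IntegrableOn (remainderIntegrand Y s u x) (Ioi 0) ∧
    fracLaplacian Y s u x = fracDirichletToNeumann Y (2 * s) u x + remainderOperator Y s u x := by
  have ha : (0 : ℝ) ≤ ((n : ℝ) - 2) / 2 := by
    have : (2 : ℝ) ≤ n := by exact_mod_cast hn
    linarith
  have hC : remainderOperator Y s u x = remainderConst (((n : ℝ) - 2) / 2) s *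
      ∫ t in Ioi (0 : ℝ), remainderIntegrand Y s u x t := by
    rw [remainderOperator, remainderConst, mul_div_cancel₀ _ (two_ne_zero' ℝ)]
  have hri (t : ℝ) : remainderIntegrand Y s u x t = Real.exp (-t * (((n : ℝ) - 2) / 2)) *
      poissonSemigroup Y t u x * truncatedBesselI (-s - 1 / 2) (((n : ℝ) - 2) / 2 * t) /
      t ^ (1 / 2 + s) := rfl
  have hEig := eigenvalue_eq n
  have ha' : n ≠ 2 → (0 : ℝ) < ((n : ℝ) - 2) / 2 := by
    intro h
    have : (3 : ℝ) ≤ n := by exact_mod_cast (by omega : 3 ≤ n)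
    linarith
  have hzero : n = 2 → ∀ t, remainderIntegrand Y s u x t = 0 := by
    rintro rfl
    exact remainderIntegrand_eq_zero Y hs0 hs1 u x
  have ha2 : n = 2 → ((n : ℝ) - 2) / 2 = 0 := by rintro rfl; norm_num
  rw [hC]
  simp only [fracLaplacian, fracDirichletToNeumann, dirichletToNeumannFun]
  simp only [poissonSemigroup, dirichletToNeumannFun] at hri
  simp_rw [hEig]
  -- From here `a` is an arbitrary real number; the facts on `n` still needed are kept in `ha`,
  -- `ha'`, `ha2` and `hzero`.
  generalize ((n : ℝ) - 2) / 2 = a at *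
  generalize hpk : (fun k : ℕ => proj Y k u x) = p at *
  have hpk' (k : ℕ) : proj Y k u x = p k := congrFun hpk k
  simp_rw [hpk'] at *
  have hμ (k : ℕ) : a ≤ (k : ℝ) + a := by have : (0 : ℝ) ≤ k := k.cast_nonneg; linarith
  have hpow (k : ℕ) : ((k : ℝ) + a) ^ (2 * s) = (((k : ℝ) + a) ^ 2) ^ s := by
    rw [Real.rpow_mul (ha.trans (hμ k)), Real.rpow_two]
  -- The `-1` leaves room for the `1 +` of `rpow_le_one_add`.
  have hμbd (k : ℕ) : ((k : ℝ) + a) ^ 2 ≤ 2 * (1 + a ^ 2) * (1 + (k : ℝ) ^ 2) - 1 := by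
    nlinarith [sq_nonneg ((k : ℝ) - a), sq_nonneg ((k : ℝ) * a)]
  have hl0 (k : ℕ) : 0 ≤ ((k : ℝ) + a) ^ 2 - a ^ 2 := by
    have := pow_le_pow_left₀ ha (hμ k) 2
    linarith
  have hS1 : Summable fun k : ℕ => (((k : ℝ) + a) ^ 2 - a ^ 2) ^ s * p k := by
    refine Summable.of_norm_bounded (hp.mul_left (2 * (1 + a ^ 2))) fun k => ?_
    rw [norm_mul, Real.norm_of_nonneg (Real.rpow_nonneg (hl0 k) _), Real.norm_eq_abs, ← mul_assoc]
    gcongr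
    have := rpow_le_one_add (hl0 k) hs0.le hs1.le
    nlinarith [hμbd k, sq_nonneg a]
  have hS2 : Summable fun k : ℕ => ((k : ℝ) + a) ^ (2 * s) * p k := by
    refine Summable.of_norm_bounded (hp.mul_left (2 * (1 + a ^ 2))) fun k => ?_
    rw [hpow, norm_mul, Real.norm_of_nonneg (by positivity), Real.norm_eq_abs, ← mul_assoc]
    gcongr
    have := rpow_le_one_add (sq_nonneg ((k : ℝ) + a)) hs0.le hs1.le
    nlinarith [hμbd k, sq_nonneg a]
  have hS3 (t : ℝ) (ht : 0 ≤ t) : Summable fun k : ℕ => Real.exp (-t * (k : ℝ)) * p k := by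
    refine Summable.of_norm_bounded hp fun k => ?_
    rw [norm_mul, Real.norm_of_nonneg (by positivity), Real.norm_eq_abs]
    gcongr
    have : Real.exp (-t * (k : ℝ)) ≤ 1 := by
      rw [Real.exp_le_one_iff]
      have : 0 ≤ t * (k : ℝ) := by positivity
      linarith
    nlinarith [sq_nonneg (k : ℝ)]
  refine ⟨hS1, hS2, hS3, ?_⟩
  by_cases hn2 : n = 2
  · have h0 := funext (hzero hn2)
    rw [h0, ha2 hn2]
    refine ⟨integrableOn_zero, ?_⟩
    simp only [integral_zero, mul_zero, add_zero]
    refine tsum_congr fun k => ?_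
    have := hpow k
    rw [ha2 hn2, add_zero] at this
    rw [this]
    norm_num
  have ha0 := ha' hn2
  have hker (k : ℕ) := kernel_integral ha0 (hμ k) hs0 hs1
  have hCne := (remainderConst_neg ha0 hs0 hs1).ne
  have hF (k : ℕ) : IntegrableOn (fun t => p k * kernel a (k + a) s t) (Ioi 0) :=
    (hker k).1.const_mul _
  -- Nonnegativity of the kernel makes the `L¹` norm exact, so its summability in `k` follows from
  -- that of the two series already treated.
  have hnorm (k : ℕ) : remainderConst a s * ∫ t in Ioi (0 : ℝ), ‖p k * kernel a (k + a) s t‖ =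
      ‖(((k : ℝ) + a) ^ 2 - a ^ 2) ^ s * p k‖ - ‖((k : ℝ) + a) ^ (2 * s) * p k‖ := by
    have : ∫ t in Ioi (0 : ℝ), ‖p k * kernel a (k + a) s t‖ =
        ∫ t in Ioi (0 : ℝ), |p k| * kernel a (k + a) s t :=
      setIntegral_congr_fun measurableSet_Ioi fun t ht => by
        rw [norm_mul, Real.norm_of_nonneg (kernel_nonneg ha0 hs1 ht), Real.norm_eq_abs]
    rw [this, integral_const_mul, mul_left_comm, (hker k).2, norm_mul, norm_mul,
      Real.norm_of_nonneg (Real.rpow_nonneg (hl0 k) _),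
      Real.norm_of_nonneg (Real.rpow_nonneg (ha.trans (hμ k)) _), Real.norm_eq_abs]
    ring
  have hFS : Summable fun k : ℕ => ∫ t in Ioi (0 : ℝ), ‖p k * kernel a (k + a) s t‖ := by
    rw [← summable_mul_left_iff hCne]
    simp_rw [hnorm]
    exact hS1.norm.sub hS2.norm
  have hEq : EqOn (fun t => ∑' k : ℕ, p k * kernel a (k + a) s t) (remainderIntegrand Y s u x)
      (Ioi 0) := by
    intro t ht
    simp only
    rw [hri, ← tsum_mul_left, ← tsum_mul_right, ← tsum_div_const]
    refine tsum_congr fun k => ?_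
    rw [kernel, mul_add, Real.exp_add]
    ring
  refine ⟨IntegrableOn.congr_fun (integrable_tsum_of_summable_integral_norm hF hFS) hEq
    measurableSet_Ioi, ?_⟩
  rw [← setIntegral_congr_fun measurableSet_Ioi hEq,
    ← integral_tsum_of_summable_integral_norm hF hFS, ← tsum_mul_left, ← hS2.tsum_add]
  · refine tsum_congr fun k => ?_
    rw [integral_const_mul, mul_left_comm, (hker k).2]
    ring
  · refine (hS1.sub hS2).congr fun k => ?_
    rw [integral_const_mul, mul_left_comm, (hker k).2]
    ring

/-! ### Polynomial functions and infinitesimal rotations of polynomials -/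

section Polynomials

open MvPolynomial

variable {n : ℕ}

/-- The function on Euclidean space defined by a polynomial. -/
noncomputable def polyFun (p : MvPolynomial (Fin n) ℝ) (X : EuclideanSpace ℝ (Fin n)) : ℝ :=
  aeval (fun i => X i) p

/-- The `i`-th vector of the standard basis. -/
noncomputable abbrev stdVec (i : Fin n) : EuclideanSpace ℝ (Fin n) := EuclideanSpace.single i 1

theorem polyFun_C (a : ℝ) : polyFun (n := n) (C a) = fun _ => a := by ext; simp [polyFun]

theorem polyFun_add (p q : MvPolynomial (Fin n) ℝ) : polyFun (p + q) = polyFun p + polyFun q := by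
  ext; simp [polyFun]

theorem polyFun_mul (p q : MvPolynomial (Fin n) ℝ) : polyFun (p * q) = polyFun p * polyFun q := by
  ext; simp [polyFun]

theorem polyFun_X (i : Fin n) : polyFun (X i : MvPolynomial (Fin n) ℝ) = fun Z => Z i := by
  ext; simp [polyFun]

theorem polyFun_sub (p q : MvPolynomial (Fin n) ℝ) : polyFun (p - q) = polyFun p - polyFun q := by
  ext; simp [polyFun]

theorem polyFun_sum {ι : Type*} (s : Finset ι) (p : ι → MvPolynomial (Fin n) ℝ) :
    polyFun (∑ i ∈ s, p i) = ∑ i ∈ s, polyFun (p i) := by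
  ext; simp [polyFun]

theorem contDiff_polyFun (p : MvPolynomial (Fin n) ℝ) {m : WithTop ℕ∞} :
    ContDiff ℝ m (polyFun p) := by
  induction p using MvPolynomial.induction_on with
  | C a => rw [polyFun_C]; exact contDiff_const
  | add p q hp hq => rw [polyFun_add]; exact hp.add hq
  | mul_X p i hp => rw [polyFun_mul, polyFun_X]; exact hp.mul (by fun_prop)

theorem fderiv_polyFun (p : MvPolynomial (Fin n) ℝ) (X : EuclideanSpace ℝ (Fin n)) (i : Fin n) :
    fderiv ℝ (polyFun p) X (stdVec i) = polyFun (pderiv i p) X := by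
  have hd (p : MvPolynomial (Fin n) ℝ) : DifferentiableAt ℝ (polyFun p) X :=
    (contDiff_polyFun p (m := 1)).differentiable one_ne_zero X
  induction p using MvPolynomial.induction_on with
  | C a => simp [polyFun_C, polyFun]
  | add p q hp hq => simp [polyFun_add, fderiv_add (hd p) (hd q), hp, hq]
  | mul_X p j hp =>
    have h2 : HasFDerivAt (fun X : EuclideanSpace ℝ (Fin n) => X j)
        (EuclideanSpace.proj (𝕜 := ℝ) j : EuclideanSpace ℝ (Fin n) →L[ℝ] ℝ) X :=
      (EuclideanSpace.proj (𝕜 := ℝ) j : EuclideanSpace ℝ (Fin n) →L[ℝ] ℝ).hasFDerivAt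
    rw [polyFun_mul, polyFun_X, ((hd p).hasFDerivAt.mul h2).fderiv]
    simp only [add_apply, smul_apply, hp, smul_eq_mul]
    by_cases h : i = j
    · subst h; simp [Derivation.leibniz, polyFun_add, polyFun_mul, polyFun_X]
    · simp [Derivation.leibniz, polyFun_mul, polyFun_X, pderiv_X_of_ne (Ne.symm h), Ne.symm h]

theorem polyFun_smul {p : MvPolynomial (Fin n) ℝ} {k : ℕ} (hp : p.IsHomogeneous k) (c : ℝ)
    (X : EuclideanSpace ℝ (Fin n)) : polyFun p (c • X) = c ^ k * polyFun p X := by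
  simp only [polyFun, aeval_eq_eval, eval_eq', Finset.mul_sum]
  refine Finset.sum_congr rfl fun d hd => ?_
  have hdk : ∑ i, d i = k := by
    rw [← hp (mem_support_iff.1 hd), Finsupp.weight_apply, Finsupp.sum_fintype] <;> simp
  simp only [PiLp.smul_apply, smul_eq_mul, mul_pow, Finset.prod_mul_distrib,
    Finset.prod_pow_eq_pow_sum, hdk]
  ring

/-- The infinitesimal rotation `X_i ∂_j - X_j ∂_i` on polynomials. -/
noncomputable def polyRot (i j : Fin n) (p : MvPolynomial (Fin n) ℝ) : MvPolynomial (Fin n) ℝ :=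
  X i * pderiv j p - X j * pderiv i p

/-- Expanding the squares leaves `|X|² Δp`, which vanishes, and terms evaluated by Euler's identity
for `p` and its first derivatives. The sum runs over ordered pairs, so each rotation is counted
twice, whence the factor `2`. -/
theorem sum_polyRot_polyRot {p : MvPolynomial (Fin n) ℝ} {k : ℕ} (hp : p.IsHomogeneous k)
    (hΔ : polyLaplacian n p = 0) :
    ∑ i, ∑ j, polyRot i j (polyRot i j p) = C (-2 * eigenvalue n k) * p := by
  have hE := hp.sum_X_mul_pderiv
  have hS : ∑ i, ∑ j, X i * X j * pderiv j (pderiv i p) = (k * (k - 1) : MvPolynomial _ ℝ) * p := by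
    have h1 (i : Fin n) : ∑ j, X i * X j * pderiv j (pderiv i p) =
        (k - 1 : MvPolynomial _ ℝ) * (X i * pderiv i p) := by
      simp_rw [mul_assoc, ← Finset.mul_sum]
      rw [(hp.pderiv (i := i)).sum_X_mul_pderiv]
      -- The degree `k - 1` of `pderiv i p` is a truncated subtraction; for `k = 0` the polynomial
      -- is constant.
      rcases k with _ | k
      · have : pderiv i p = 0 := by
          rw [← totalDegree_zero_iff_isHomogeneous, totalDegree_eq_zero_iff_eq_C] at hp
          rw [hp, pderiv_C]
        simp [this]
      · simp [nsmul_eq_mul]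
        ring
    simp_rw [h1, ← Finset.mul_sum, hE, nsmul_eq_mul]
    ring
  have hS2 : ∑ i, ∑ j, X i * X j * pderiv i (pderiv j p) =
      (k * (k - 1) : MvPolynomial _ ℝ) * p := by
    rw [Finset.sum_comm, ← hS]
    simp_rw [mul_comm (X (R := ℝ) _ : MvPolynomial (Fin n) ℝ) (X _)]
  have hL : ∑ i, pderiv i (pderiv i p) = 0 := by
    simpa [polyLaplacian] using hΔ
  have hD (i j : Fin n) : polyRot i j (polyRot i j p) =
      (if i = j then X i * pderiv i p else 0) + X i ^ 2 * pderiv j (pderiv j p)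
      - X i * pderiv i p - X i * X j * pderiv j (pderiv i p) - X j * pderiv j p
      - X i * X j * pderiv i (pderiv j p) + (if i = j then X i * pderiv i p else 0)
      + X j ^ 2 * pderiv i (pderiv i p) := by
    simp only [polyRot, map_sub, Derivation.leibniz, smul_eq_mul, pderiv_X_self]
    by_cases h : i = j
    · subst h; simp; ring
    · simp [pderiv_X_of_ne h, pderiv_X_of_ne (Ne.symm h), h]; ring
  have hXp : ∑ i, ∑ _j : Fin n, X i * pderiv i p = (n * k : MvPolynomial (Fin n) ℝ) * p := by
    simp only [Finset.sum_const, Finset.card_univ, Fintype.card_fin, nsmul_eq_mul,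
      ← Finset.mul_sum, hE, mul_assoc]
  have hXp' : ∑ _i : Fin n, ∑ j, X j * pderiv j p = (n * k : MvPolynomial (Fin n) ℝ) * p := by
    rw [Finset.sum_comm, hXp]
  have hL1 : ∑ i, ∑ j, X i ^ 2 * pderiv j (pderiv j p) = 0 := by
    simp only [← Finset.mul_sum, hL, mul_zero, Finset.sum_const_zero]
  have hL2 : ∑ i, ∑ j, X j ^ 2 * pderiv i (pderiv i p) = 0 := by
    rw [Finset.sum_comm, hL1]
  simp_rw [hD, Finset.sum_add_distrib, Finset.sum_sub_distrib, Finset.sum_add_distrib]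
  rw [hS, hS2, hXp, hXp', hL1, hL2]
  simp only [Finset.sum_ite_eq, Finset.mem_univ, if_true, hE, nsmul_eq_mul, eigenvalue]
  simp only [map_mul, map_neg, map_add, map_sub, map_natCast, map_ofNat]
  ring

end Polynomials

/-! ### Infinitesimal rotations of functions on `ℝⁿ` and integration by parts -/

section Rotations

open MvPolynomial

variable {n : ℕ}

/-- The infinitesimal rotation `X_i ∂_j - X_j ∂_i`. -/
noncomputable def rot (i j : Fin n) (f : EuclideanSpace ℝ (Fin n) → ℝ)
    (X : EuclideanSpace ℝ (Fin n)) : ℝ :=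
  X i * fderiv ℝ f X (stdVec j) - X j * fderiv ℝ f X (stdVec i)

/-- Twice the Laplacian of the sphere, `∑_{i,j} (X_i ∂_j - X_j ∂_i)²`. -/
noncomputable def rotLaplacian (f : EuclideanSpace ℝ (Fin n) → ℝ) :
    EuclideanSpace ℝ (Fin n) → ℝ :=
  ∑ i, ∑ j, rot i j (rot i j f)

variable {f g φ : EuclideanSpace ℝ (Fin n) → ℝ}

theorem contDiff_fderiv_apply (hf : ContDiff ℝ ∞ f) (v : EuclideanSpace ℝ (Fin n)) :
    ContDiff ℝ ∞ fun X => fderiv ℝ f X v :=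
  (hf.fderiv_right (m := ∞) (by simp)).clm_apply contDiff_const

theorem contDiff_coord (i : Fin n) : ContDiff ℝ ∞ fun X : EuclideanSpace ℝ (Fin n) => X i :=
  (EuclideanSpace.proj (𝕜 := ℝ) i : EuclideanSpace ℝ (Fin n) →L[ℝ] ℝ).contDiff

theorem contDiff_rot (hf : ContDiff ℝ ∞ f) (i j : Fin n) : ContDiff ℝ ∞ (rot i j f) :=
  ((contDiff_coord i).mul (contDiff_fderiv_apply hf _)).sub
    ((contDiff_coord j).mul (contDiff_fderiv_apply hf _))

theorem hasCompactSupport_rot (hf : HasCompactSupport f) (i j : Fin n) :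
    HasCompactSupport (rot i j f) :=
  ((hf.fderiv_apply (𝕜 := ℝ) _).mul_left).sub ((hf.fderiv_apply (𝕜 := ℝ) _).mul_left)

theorem rot_polyFun (p : MvPolynomial (Fin n) ℝ) (i j : Fin n) :
    rot i j (polyFun p) = polyFun (polyRot i j p) := by
  ext X
  simp [rot, polyRot, polyFun_sub, polyFun_mul, polyFun_X, fderiv_polyFun]

/-- Leibniz rule. It lets radial cutoffs pass through the rotations. -/
theorem rot_mul_of_rot_eq_zero (hφ : ContDiff ℝ ∞ φ) (hg : ContDiff ℝ ∞ g) {i j : Fin n}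
    (h : rot i j φ = 0) : rot i j (φ * g) = φ * rot i j g := by
  ext X
  have hφd := (hφ.differentiable (by simp)) X
  have hgd := (hg.differentiable (by simp)) X
  have h0 := congrFun h X
  simp only [rot, Pi.zero_apply] at h0
  simp only [rot, Pi.mul_apply, fderiv_mul hφd hgd, add_apply, smul_apply, smul_eq_mul]
  linear_combination g X * h0

/-- The field `X_i ∂_j - X_j ∂_i` is divergence free: the derivatives falling on the coordinates
give `δ_ij` twice, with opposite signs. -/
theorem integral_mul_rot (hf : ContDiff ℝ ∞ f) (hfc : HasCompactSupport f) (hg : ContDiff ℝ ∞ g)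
    (i j : Fin n) : ∫ X, f X * rot i j g X = -∫ X, rot i j f X * g X := by
  have hint {a b : EuclideanSpace ℝ (Fin n) → ℝ} (ha : Continuous a) (hc : HasCompactSupport a)
      (hb : Continuous b) : Integrable (fun X => a X * b X) :=
    (ha.mul hb).integrable_of_hasCompactSupport hc.mul_right
  have hd (v : EuclideanSpace ℝ (Fin n)) {a : EuclideanSpace ℝ (Fin n) → ℝ}
      (ha : ContDiff ℝ ∞ a) : Continuous fun X => fderiv ℝ a X v :=
    (contDiff_fderiv_apply ha v).continuous
  have key (i j : Fin n) : ∫ X, f X * X i * fderiv ℝ g X (stdVec j) =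
      -∫ X, (fderiv ℝ f X (stdVec j) * X i + f X * stdVec j i) * g X := by
    have hF : ContDiff ℝ ∞ fun X => f X * X i := hf.mul (contDiff_coord i)
    have hFc : HasCompactSupport fun X => f X * X i := hfc.mul_right
    have hF' (X : EuclideanSpace ℝ (Fin n)) : fderiv ℝ (fun X => f X * X i) X (stdVec j) =
        fderiv ℝ f X (stdVec j) * X i + f X * stdVec j i := by
      have h2 : HasFDerivAt (fun X : EuclideanSpace ℝ (Fin n) => X i)
          (EuclideanSpace.proj (𝕜 := ℝ) i : EuclideanSpace ℝ (Fin n) →L[ℝ] ℝ) X :=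
        (EuclideanSpace.proj (𝕜 := ℝ) i : EuclideanSpace ℝ (Fin n) →L[ℝ] ℝ).hasFDerivAt
      rw [((hf.differentiable (by simp) X).hasFDerivAt.fun_mul h2).fderiv]
      simp [mul_comm, add_comm]
    simp_rw [← hF']
    exact integral_mul_fderiv_eq_neg_fderiv_mul_of_integrable
      (hint (hd _ hF) (hFc.fderiv_apply (𝕜 := ℝ) _) hg.continuous)
      (hint hF.continuous hFc (hd _ hg)) (hint hF.continuous hFc hg.continuous)
      (fun X _ => hF.differentiable (by simp) X) (fun X _ => hg.differentiable (by simp) X)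
  have hi (i j : Fin n) : Integrable fun X => f X * X i * fderiv ℝ g X (stdVec j) :=
    hint (hf.mul (contDiff_coord i)).continuous hfc.mul_right (hd _ hg)
  have hi' (i j : Fin n) :
      Integrable fun X => (fderiv ℝ f X (stdVec j) * X i + f X * stdVec j i) * g X := by
    refine hint ?_ ?_ hg.continuous
    · exact ((hd _ hf).mul (contDiff_coord i).continuous).add (hf.continuous.mul continuous_const)
    · exact HasCompactSupport.add ((hfc.fderiv_apply (𝕜 := ℝ) _).mul_right) hfc.mul_right
  calc ∫ X, f X * rot i j g X
      = ∫ X, (f X * X i * fderiv ℝ g X (stdVec j) - f X * X j * fderiv ℝ g X (stdVec i)) := by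
        congr 1; ext X; rw [rot]; ring
    _ = -∫ X, ((fderiv ℝ f X (stdVec j) * X i + f X * stdVec j i) * g X -
          (fderiv ℝ f X (stdVec i) * X j + f X * stdVec i j) * g X) := by
        rw [integral_sub (hi i j) (hi j i), integral_sub (hi' i j) (hi' j i), key, key]
        ring
    _ = _ := by
        congr 2
        ext X
        have : (stdVec j : EuclideanSpace ℝ (Fin n)) i = (stdVec i : EuclideanSpace ℝ (Fin n)) j := by
          simp [eq_comm]
        rw [rot, this]
        ring

theorem contDiff_rotLaplacian (hf : ContDiff ℝ ∞ f) : ContDiff ℝ ∞ (rotLaplacian f) := by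
  have : rotLaplacian f = fun X => ∑ i, ∑ j, rot i j (rot i j f) X := by
    ext; simp [rotLaplacian]
  rw [this]
  exact ContDiff.sum fun i _ => ContDiff.sum fun j _ => contDiff_rot (contDiff_rot hf i j) i j

theorem hasCompactSupport_rotLaplacian (hf : HasCompactSupport f) :
    HasCompactSupport (rotLaplacian f) := by
  unfold rotLaplacian
  refine Finset.sum_induction _ HasCompactSupport (fun _ _ => HasCompactSupport.add)
    HasCompactSupport.zero fun i _ => ?_
  exact Finset.sum_induction _ HasCompactSupport (fun _ _ => HasCompactSupport.add)
    HasCompactSupport.zero fun j _ => hasCompactSupport_rot (hasCompactSupport_rot hf i j) i j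

theorem rotLaplacian_mul (hφ : ContDiff ℝ ∞ φ) (hg : ContDiff ℝ ∞ g)
    (h : ∀ i j, rot i j φ = 0) : rotLaplacian (φ * g) = φ * rotLaplacian g := by
  simp only [rotLaplacian, Finset.mul_sum]
  refine Finset.sum_congr rfl fun i _ => Finset.sum_congr rfl fun j _ => ?_
  rw [rot_mul_of_rot_eq_zero hφ hg (h i j), rot_mul_of_rot_eq_zero hφ (contDiff_rot hg i j) (h i j)]

theorem contDiff_iterate_rotLaplacian (hf : ContDiff ℝ ∞ f) (M : ℕ) :
    ContDiff ℝ ∞ (rotLaplacian^[M] f) := by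
  induction M with
  | zero => exact hf
  | succ M ih => rw [Function.iterate_succ_apply']; exact contDiff_rotLaplacian ih

theorem hasCompactSupport_iterate_rotLaplacian (hf : HasCompactSupport f) (M : ℕ) :
    HasCompactSupport (rotLaplacian^[M] f) := by
  induction M with
  | zero => exact hf
  | succ M ih => rw [Function.iterate_succ_apply']; exact hasCompactSupport_rotLaplacian ih

theorem iterate_rotLaplacian_mul (hφ : ContDiff ℝ ∞ φ) (hg : ContDiff ℝ ∞ g)
    (h : ∀ i j, rot i j φ = 0) (M : ℕ) :
    rotLaplacian^[M] (φ * g) = φ * rotLaplacian^[M] g := by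
  induction M with
  | zero => rfl
  | succ M ih =>
    rw [Function.iterate_succ_apply', ih, Function.iterate_succ_apply',
      rotLaplacian_mul hφ (contDiff_iterate_rotLaplacian hg M) h]

/-- Two integrations by parts for each pair `i, j` move the operator onto the polynomial, which is
an eigenvector. -/
theorem integral_rotLaplacian_mul_polyFun (hf : ContDiff ℝ ∞ f) (hfc : HasCompactSupport f)
    {p : MvPolynomial (Fin n) ℝ} {k : ℕ} (hp : p.IsHomogeneous k) (hΔ : polyLaplacian n p = 0) :
    ∫ X, rotLaplacian f X * polyFun p X = -2 * eigenvalue n k * ∫ X, f X * polyFun p X := by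
  have h1 (i j : Fin n) : ∫ X, rot i j (rot i j f) X * polyFun p X =
      ∫ X, f X * polyFun (polyRot i j (polyRot i j p)) X := by
    rw [← rot_polyFun, integral_mul_rot hf hfc (contDiff_polyFun _), ← rot_polyFun,
      integral_mul_rot (contDiff_rot hf i j) (hasCompactSupport_rot hfc i j) (contDiff_polyFun _),
      neg_neg]
  have hint {a b : EuclideanSpace ℝ (Fin n) → ℝ} (ha : Continuous a) (hc : HasCompactSupport a)
      (hb : Continuous b) : Integrable (fun X => a X * b X) :=
    (ha.mul hb).integrable_of_hasCompactSupport hc.mul_right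
  have hpc (q : MvPolynomial (Fin n) ℝ) : Continuous (polyFun q) :=
    (contDiff_polyFun q (m := 0)).continuous
  have hi (i j : Fin n) : Integrable fun X => rot i j (rot i j f) X * polyFun p X :=
    hint (contDiff_rot (contDiff_rot hf i j) i j).continuous
      (hasCompactSupport_rot (hasCompactSupport_rot hfc i j) i j) (hpc p)
  have hi' (i j : Fin n) : Integrable fun X => f X * polyFun (polyRot i j (polyRot i j p)) X :=
    hint hf.continuous hfc (hpc _)
  calc ∫ X, rotLaplacian f X * polyFun p X
      = ∫ X, ∑ i, ∑ j, rot i j (rot i j f) X * polyFun p X := by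
        simp [rotLaplacian, Finset.sum_mul]
    _ = ∑ i, ∑ j, ∫ X, f X * polyFun (polyRot i j (polyRot i j p)) X := by
        rw [integral_finsetSum _ fun i _ => integrable_finsetSum _ fun j _ => hi i j]
        refine Finset.sum_congr rfl fun i _ => ?_
        rw [integral_finsetSum _ fun j _ => hi i j]
        simp_rw [h1]
    _ = ∫ X, ∑ i, ∑ j, f X * polyFun (polyRot i j (polyRot i j p)) X := by
        rw [integral_finsetSum _ fun i _ => integrable_finsetSum _ fun j _ => hi' i j]
        refine Finset.sum_congr rfl fun i _ => ?_
        rw [integral_finsetSum _ fun j _ => hi' i j]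
    _ = ∫ X, -2 * eigenvalue n k * (f X * polyFun p X) := by
        congr 1
        ext X
        have := congrFun (congrArg polyFun (sum_polyRot_polyRot hp hΔ)) X
        simp only [polyFun_sum, polyFun_mul, polyFun_C, Finset.sum_apply, Pi.mul_apply] at this
        simp_rw [← Finset.mul_sum, this]
        ring
    _ = _ := integral_const_mul _ _

theorem integral_iterate_rotLaplacian_mul_polyFun (hf : ContDiff ℝ ∞ f)
    (hfc : HasCompactSupport f) {p : MvPolynomial (Fin n) ℝ} {k : ℕ} (hp : p.IsHomogeneous k)
    (hΔ : polyLaplacian n p = 0) (M : ℕ) :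
    ∫ X, (rotLaplacian^[M] f) X * polyFun p X =
      (-2 * eigenvalue n k) ^ M * ∫ X, f X * polyFun p X := by
  induction M with
  | zero => simp
  | succ M ih =>
    rw [Function.iterate_succ_apply', integral_rotLaplacian_mul_polyFun
      (contDiff_iterate_rotLaplacian hf M) (hasCompactSupport_iterate_rotLaplacian hfc M) hp hΔ, ih]
    ring

end Rotations

/-! ### The mean value property of harmonic polynomials, with a radial weight -/

section MeanValue

open MvPolynomial

variable {n : ℕ}

/-- Squaring makes the positive part `C¹`, so that `capWeight ^ 2` can be differentiated across the
unit sphere. -/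
theorem hasDerivAt_max_zero_sq (t : ℝ) :
    HasDerivAt (fun t : ℝ => (max 0 t) ^ 2) (2 * max 0 t) t := by
  rcases lt_trichotomy t 0 with h | rfl | h
  · rw [max_eq_left h.le, mul_zero]
    refine (hasDerivAt_const t (0 : ℝ)).congr_of_eventuallyEq ?_
    filter_upwards [Iio_mem_nhds h] with y hy
    simp [max_eq_left (mem_Iio.1 hy).le]
  · have h1 : HasDerivWithinAt (fun t : ℝ => (max 0 t) ^ 2) 0 (Iic 0) 0 :=
      (hasDerivWithinAt_const (0 : ℝ) _ (0 : ℝ)).congr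
        (fun y hy => by simp [max_eq_left (mem_Iic.1 hy)]) (by simp)
    have h2 : HasDerivWithinAt (fun t : ℝ => (max 0 t) ^ 2) 0 (Ici 0) 0 := by
      have := ((hasDerivAt_id (0 : ℝ)).pow 2).hasDerivWithinAt (s := Ici 0)
      simp only [id, pow_one, mul_one, mul_zero, Nat.cast_ofNat, Nat.add_one_sub_one] at this
      exact this.congr (fun y hy => by simp [max_eq_right (mem_Ici.1 hy)]) (by simp)
    have := h1.union h2
    rw [Iic_union_Ici, hasDerivWithinAt_univ] at this
    simpa using this
  · rw [max_eq_right h.le]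
    have := (hasDerivAt_id t).pow 2
    simp only [id, pow_one, mul_one, Nat.cast_ofNat, Nat.add_one_sub_one] at this
    refine this.congr_of_eventuallyEq ?_
    filter_upwards [Ioi_mem_nhds h] with y hy
    simp [max_eq_right (mem_Ioi.1 hy).le]

/-- The weight `(1 - |y|²)₊`. -/
noncomputable def capWeight (y : EuclideanSpace ℝ (Fin n)) : ℝ := max 0 (1 - ‖y‖ ^ 2)

theorem continuous_capWeight : Continuous (capWeight (n := n)) := by
  unfold capWeight; fun_prop

theorem capWeight_nonneg (y : EuclideanSpace ℝ (Fin n)) : 0 ≤ capWeight y := le_max_left _ _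

theorem capWeight_le_one (y : EuclideanSpace ℝ (Fin n)) : capWeight y ≤ 1 :=
  max_le zero_le_one (by nlinarith [sq_nonneg ‖y‖])

theorem capWeight_eq_zero {y : EuclideanSpace ℝ (Fin n)} (hy : 1 ≤ ‖y‖) : capWeight y = 0 :=
  max_eq_left (by nlinarith)

theorem hasCompactSupport_capWeight : HasCompactSupport (capWeight (n := n)) :=
  HasCompactSupport.intro (isCompact_closedBall 0 1) fun y hy =>
    capWeight_eq_zero (by simpa using (lt_of_not_ge fun h => hy (by simpa using h)).le)

theorem integral_capWeight_pos : 0 < ∫ y : EuclideanSpace ℝ (Fin n), capWeight y := by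
  refine continuous_capWeight.integral_pos_of_hasCompactSupport_nonneg_nonzero
    hasCompactSupport_capWeight capWeight_nonneg (x := 0) ?_
  simp [capWeight]

theorem hasFDerivAt_capWeight_sq (y : EuclideanSpace ℝ (Fin n)) :
    HasFDerivAt (fun y : EuclideanSpace ℝ (Fin n) => capWeight y ^ 2)
      ((-4 * capWeight y) • innerSL ℝ y) y := by
  have h1 : HasFDerivAt (fun y : EuclideanSpace ℝ (Fin n) => 1 - ‖y‖ ^ 2)
      (-(2 • innerSL ℝ y)) y := ((hasStrictFDerivAt_norm_sq y).hasFDerivAt).const_sub 1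
  have := (hasDerivAt_max_zero_sq (1 - ‖y‖ ^ 2)).comp_hasFDerivAt y h1
  refine this.congr_fderiv ?_
  ext v
  simp [capWeight]
  ring

theorem fderiv_capWeight_sq (y : EuclideanSpace ℝ (Fin n)) (i : Fin n) :
    fderiv ℝ (fun y : EuclideanSpace ℝ (Fin n) => capWeight y ^ 2) y (stdVec i) =
      -4 * capWeight y * y i := by
  rw [(hasFDerivAt_capWeight_sq y).fderiv]
  simp [EuclideanSpace.inner_single_right]

theorem fderiv_polyFun_apply (p : MvPolynomial (Fin n) ℝ) (X v : EuclideanSpace ℝ (Fin n)) :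
    fderiv ℝ (polyFun p) X v = ∑ i, v i * polyFun (pderiv i p) X := by
  have hv : v = ∑ i, v i • (stdVec i : EuclideanSpace ℝ (Fin n)) := by
    have := (EuclideanSpace.basisFun (Fin n) ℝ).sum_repr v
    simpa using this.symm
  conv_lhs => rw [hv]
  simp [map_sum, fderiv_polyFun]

theorem hasFDerivAt_polyFun (p : MvPolynomial (Fin n) ℝ) (X : EuclideanSpace ℝ (Fin n)) :
    HasFDerivAt (polyFun p) (fderiv ℝ (polyFun p) X) X :=
  ((contDiff_polyFun p (m := 1)).differentiable one_ne_zero X).hasFDerivAt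

theorem continuous_polyFun (p : MvPolynomial (Fin n) ℝ) : Continuous (polyFun p) :=
  (contDiff_polyFun p (m := 0)).continuous

theorem hasDerivAt_polyFun_ray (p : MvPolynomial (Fin n) ℝ) (x y : EuclideanSpace ℝ (Fin n))
    (r : ℝ) : HasDerivAt (fun r : ℝ => polyFun p (x + r • y))
      (∑ i, y i * polyFun (pderiv i p) (x + r • y)) r := by
  rw [← fderiv_polyFun_apply]
  have h : HasDerivAt (fun r : ℝ => x + r • y) y r := by
    simpa using ((hasDerivAt_id r).smul_const y).const_add x
  exact (hasFDerivAt_polyFun p _).comp_hasDerivAt r h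

theorem hasFDerivAt_polyFun_affine (p : MvPolynomial (Fin n) ℝ) (x y : EuclideanSpace ℝ (Fin n))
    (r : ℝ) : HasFDerivAt (fun y => polyFun p (x + r • y))
      (r • fderiv ℝ (polyFun p) (x + r • y)) y := by
  have h : HasFDerivAt (fun y : EuclideanSpace ℝ (Fin n) => x + r • y)
      (r • ContinuousLinearMap.id ℝ (EuclideanSpace ℝ (Fin n))) y :=
    ((hasFDerivAt_id y).const_smul r).const_add x
  refine ((hasFDerivAt_polyFun p _).comp y h).congr_fderiv ?_
  ext v
  simp

/-- With `w = capWeight`, one has `∇(w²) = -4 w y`. Integration by parts turns the integral, up to a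
constant factor, into `r ∫ w² Δp(x + r y) dy = 0`. -/
theorem integral_capWeight_mul_radial {p : MvPolynomial (Fin n) ℝ} (hΔ : polyLaplacian n p = 0)
    (x : EuclideanSpace ℝ (Fin n)) (r : ℝ) :
    ∫ y, capWeight y * ∑ i, y i * polyFun (pderiv i p) (x + r • y) = 0 := by
  have hc (q : MvPolynomial (Fin n) ℝ) : Continuous fun y => polyFun q (x + r • y) :=
    (continuous_polyFun q).comp (by fun_prop)
  have hcs : HasCompactSupport fun y : EuclideanSpace ℝ (Fin n) => capWeight y ^ 2 := by
    simp_rw [sq]; exact hasCompactSupport_capWeight.mul_right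
  have hcc : Continuous fun y : EuclideanSpace ℝ (Fin n) => capWeight y ^ 2 :=
    continuous_capWeight.pow 2
  have hW (i : Fin n) : Integrable fun y : EuclideanSpace ℝ (Fin n) =>
      -4 * capWeight y * y i * polyFun (pderiv i p) (x + r • y) := by
    refine Continuous.integrable_of_hasCompactSupport ?_ ?_
    · exact ((continuous_const.mul continuous_capWeight).mul (by fun_prop)).mul (hc _)
    · exact (hasCompactSupport_capWeight.mul_left.mul_right).mul_right
  have hΦ (q : MvPolynomial (Fin n) ℝ) : Integrable fun y : EuclideanSpace ℝ (Fin n) =>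
      capWeight y ^ 2 * polyFun q (x + r • y) :=
    (hcc.mul (hc q)).integrable_of_hasCompactSupport hcs.mul_right
  have hfd (q : MvPolynomial (Fin n) ℝ) (i : Fin n) (y : EuclideanSpace ℝ (Fin n)) :
      fderiv ℝ (fun y => polyFun q (x + r • y)) y (stdVec i) =
        r * polyFun (pderiv i q) (x + r • y) := by
    rw [(hasFDerivAt_polyFun_affine q x y r).fderiv, smul_apply,
      fderiv_polyFun, smul_eq_mul]
  have key (i : Fin n) :
      ∫ y, -4 * capWeight y * y i * polyFun (pderiv i p) (x + r • y) =
        -(r * ∫ y, capWeight y ^ 2 * polyFun (pderiv i (pderiv i p)) (x + r • y)) := by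
    have := integral_mul_fderiv_eq_neg_fderiv_mul_of_integrable (μ := volume)
      (f := fun y : EuclideanSpace ℝ (Fin n) => capWeight y ^ 2)
      (g := fun y => polyFun (pderiv i p) (x + r • y)) (v := stdVec i)
      (by simpa only [fderiv_capWeight_sq] using hW i)
      (by
        simp only [hfd]
        simpa only [mul_left_comm] using (hΦ (pderiv i (pderiv i p))).const_mul r)
      (hΦ _)
      (fun y _ => (hasFDerivAt_capWeight_sq y).differentiableAt)
      (fun y _ => (hasFDerivAt_polyFun_affine _ x y r).differentiableAt)
    simp only [fderiv_capWeight_sq, hfd, mul_left_comm _ r] at this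
    rw [integral_const_mul] at this
    rw [this, neg_neg]
  have h4 : ∫ y, -4 * (capWeight y * ∑ i, y i * polyFun (pderiv i p) (x + r • y)) = 0 := by
    calc _ = ∫ y, ∑ i, -4 * capWeight y * y i * polyFun (pderiv i p) (x + r • y) := by
          congr 1; ext y; simp_rw [Finset.mul_sum, mul_assoc]
      _ = -(r * ∫ y, ∑ i, capWeight y ^ 2 * polyFun (pderiv i (pderiv i p)) (x + r • y)) := by
          rw [integral_finsetSum _ fun i _ => hW i, integral_finsetSum _ fun i _ => hΦ _]
          simp_rw [key, Finset.mul_sum, Finset.sum_neg_distrib]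
      _ = 0 := by
          have h0 : ∑ i, pderiv i (pderiv i p) = 0 := by simpa [polyLaplacian] using hΔ
          have (y : EuclideanSpace ℝ (Fin n)) :
              ∑ i, capWeight y ^ 2 * polyFun (pderiv i (pderiv i p)) (x + r • y) = 0 := by
            have h1 := congrFun (congrArg polyFun h0) (x + r • y)
            rw [polyFun_sum, Finset.sum_apply] at h1
            rw [← Finset.mul_sum, h1]
            simp [polyFun]
          simp [this]
  rw [integral_const_mul] at h4
  simpa using h4

/-- The mean value property of harmonic polynomials. -/
theorem integral_capWeight_mul_polyFun {p : MvPolynomial (Fin n) ℝ} (hΔ : polyLaplacian n p = 0)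
    (x : EuclideanSpace ℝ (Fin n)) (r : ℝ) :
    ∫ y, capWeight y * polyFun p (x + r • y) =
      (∫ y : EuclideanSpace ℝ (Fin n), capWeight y) * polyFun p x := by
  have hc (q : MvPolynomial (Fin n) ℝ) :
      Continuous fun z : ℝ × EuclideanSpace ℝ (Fin n) => polyFun q (x + z.1 • z.2) :=
    (continuous_polyFun q).comp (by fun_prop)
  have hF' : Continuous fun z : ℝ × EuclideanSpace ℝ (Fin n) =>
      capWeight z.2 * ∑ i, z.2 i * polyFun (pderiv i p) (x + z.1 • z.2) := by
    refine (continuous_capWeight.comp continuous_snd).mul (continuous_finsetSum _ fun i _ => ?_)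
    exact Continuous.mul (by fun_prop) (hc _)
  have hF (r : ℝ) : Continuous fun y => capWeight y * polyFun p (x + r • y) :=
    continuous_capWeight.mul ((continuous_polyFun p).comp (by fun_prop))
  have hFr (r : ℝ) : Continuous fun y =>
      capWeight y * ∑ i, y i * polyFun (pderiv i p) (x + r • y) := by
    refine continuous_capWeight.mul (continuous_finsetSum _ fun i _ => ?_)
    exact Continuous.mul (by fun_prop) ((continuous_polyFun _).comp (by fun_prop))
  -- Differentiation under the integral gives the radial integral just shown to vanish. The weight
  -- confines everything to the unit ball, so a bound on a compact set dominates.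
  have hderiv (r : ℝ) : HasDerivAt (fun r => ∫ y, capWeight y * polyFun p (x + r • y)) 0 r := by
    obtain ⟨C, hC⟩ := ((isCompact_Icc (a := r - 1) (b := r + 1)).prod
      (isCompact_closedBall (0 : EuclideanSpace ℝ (Fin n)) 1)).exists_bound_of_continuousOn
      hF'.continuousOn
    have h := hasDerivAt_integral_of_dominated_loc_of_deriv_le (μ := volume)
      (F := fun r y => capWeight y * polyFun p (x + r • y))
      (F' := fun r y => capWeight y * ∑ i, y i * polyFun (pderiv i p) (x + r • y))
      (bound := (Metric.closedBall (0 : EuclideanSpace ℝ (Fin n)) 1).indicator fun _ => C)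
      (s := Icc (r - 1) (r + 1)) (x₀ := r) (Icc_mem_nhds (by linarith) (by linarith))
      (Eventually.of_forall fun r => (hF r).aestronglyMeasurable)
      ((hF r).integrable_of_hasCompactSupport hasCompactSupport_capWeight.mul_right)
      (hFr r).aestronglyMeasurable
      (ae_of_all _ fun y t ht => ?_) ?_ (ae_of_all _ fun y t _ => ?_)
    · simpa only [integral_capWeight_mul_radial hΔ] using h.2
    · by_cases hy : y ∈ Metric.closedBall (0 : EuclideanSpace ℝ (Fin n)) 1
      · rw [indicator_of_mem hy]
        exact hC (t, y) ⟨ht, hy⟩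
      · rw [indicator_of_notMem hy, capWeight_eq_zero]
        · simp
        · simp only [Metric.mem_closedBall, dist_zero_right, not_le] at hy
          exact hy.le
    · rw [integrable_indicator_iff Metric.isClosed_closedBall.measurableSet]
      exact integrableOn_const (isCompact_closedBall _ _).measure_lt_top.ne
    · exact (hasDerivAt_polyFun_ray p x y t).const_mul _
  -- The mean does not depend on `r`, and at `r = 0` it is the value at `x` times the total weight.
  have := is_const_of_deriv_eq_zero (fun r => (hderiv r).differentiableAt)
    (fun r => (hderiv r).deriv) r 0
  rw [this]
  simp [integral_mul_const]

end MeanValue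

/-! ### Polar coordinates and the pointwise bound on spherical harmonics -/

section Polar

open MvPolynomial

variable {n : ℕ}

/-- Integration in polar coordinates of a function with separated variables. -/
theorem integral_of_polar (hn : 0 < n) {f : EuclideanSpace ℝ (Fin n) → ℝ} {a : ℝ → ℝ}
    {b : UnitSphere n → ℝ} (h : ∀ r : ℝ, 0 < r → ∀ w : UnitSphere n, f (r • w.1) = a r * b w) :
    ∫ X, f X = (∫ r in Ioi (0 : ℝ), r ^ (n - 1) * a r) * ∫ w, b w ∂(surfaceMeasure n) := by
  have : Nonempty (Fin n) := ⟨⟨0, hn⟩⟩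
  have hfin : Module.finrank ℝ (EuclideanSpace ℝ (Fin n)) = n := finrank_euclideanSpace_fin
  set μ : Measure (EuclideanSpace ℝ (Fin n)) := volume with hμ
  have hf (X : ({(0 : EuclideanSpace ℝ (Fin n))}ᶜ : Set _)) : f X =
      b (homeomorphUnitSphereProd _ X).1 * a (homeomorphUnitSphereProd _ X).2 := by
    rw [mul_comm, ← h _ (homeomorphUnitSphereProd _ X).2.2]
    congr 1
    conv_lhs => rw [← (homeomorphUnitSphereProd _).symm_apply_apply X]
    rfl
  calc ∫ X, f X ∂μ
      = ∫ X : ({(0 : EuclideanSpace ℝ (Fin n))}ᶜ : Set _), f X ∂(μ.comap (↑)) := by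
        rw [integral_subtype_comap (measurableSet_singleton _).compl f, restrict_compl_singleton]
    _ = ∫ z, b z.1 * a z.2 ∂(μ.toSphere.prod (.volumeIoiPow (n - 1))) := by
        have := μ.measurePreserving_homeomorphUnitSphereProd.integral_comp
          (Homeomorph.measurableEmbedding _) fun z => b z.1 * a z.2
        rw [hfin] at this
        rw [← this]
        simp_rw [hf]
    _ = (∫ w, b w ∂μ.toSphere) * ∫ r : Ioi (0 : ℝ), a r ∂.volumeIoiPow (n - 1) :=
        integral_prod_mul b fun r : Ioi (0 : ℝ) => a r
    _ = _ := by
        rw [mul_comm]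
        congr 1
        simp only [Measure.volumeIoiPow, ENNReal.ofReal]
        rw [integral_withDensity_eq_integral_smul,
          integral_subtype_comap measurableSet_Ioi fun r => Real.toNNReal (r ^ (n - 1)) • a r,
          setIntegral_congr_fun measurableSet_Ioi fun x hx => ?_]
        · rw [NNReal.smul_def, Real.coe_toNNReal _ (pow_nonneg (le_of_lt hx) _), smul_eq_mul]
        · exact (measurable_subtype_coe.pow_const _).real_toNNReal

/-- The weighted variance of `p` around its mean `p(x)` is nonnegative. Then the weight is bounded
by `1` on the unit ball, and scaling by `r` contributes `r⁻ⁿ`. -/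
theorem sq_polyFun_le_integral_ball {p : MvPolynomial (Fin n) ℝ} (hΔ : polyLaplacian n p = 0)
    (x : EuclideanSpace ℝ (Fin n)) {r : ℝ} (hr : 0 < r) :
    polyFun p x ^ 2 * ∫ y : EuclideanSpace ℝ (Fin n), capWeight y ≤
      (r ^ n)⁻¹ * ∫ X in Metric.ball (0 : EuclideanSpace ℝ (Fin n)) (‖x‖ + r), polyFun p X ^ 2 := by
  have hc : Continuous fun y => polyFun p (x + r • y) :=
    (continuous_polyFun p).comp (by fun_prop)
  have hi (g : EuclideanSpace ℝ (Fin n) → ℝ) (hg : Continuous g) :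
      Integrable fun y => capWeight y * g y :=
    (continuous_capWeight.mul hg).integrable_of_hasCompactSupport
      hasCompactSupport_capWeight.mul_right
  have hmean := integral_capWeight_mul_polyFun hΔ x r
  have h0 : 0 ≤ ∫ y, capWeight y * (polyFun p (x + r • y) - polyFun p x) ^ 2 :=
    integral_nonneg fun y => mul_nonneg (capWeight_nonneg y) (sq_nonneg _)
  have h1 : ∫ y, capWeight y * (polyFun p (x + r • y) - polyFun p x) ^ 2 =
      (∫ y, capWeight y * polyFun p (x + r • y) ^ 2) -
        polyFun p x ^ 2 * ∫ y : EuclideanSpace ℝ (Fin n), capWeight y := by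
    calc _ = ∫ y, (capWeight y * polyFun p (x + r • y) ^ 2 -
            2 * polyFun p x * (capWeight y * polyFun p (x + r • y)) +
            polyFun p x ^ 2 * capWeight y) := by
          congr 1; ext y; ring
      _ = _ := by
          have hcw : Integrable (capWeight (n := n)) :=
            continuous_capWeight.integrable_of_hasCompactSupport hasCompactSupport_capWeight
          have i1 : Integrable fun y => capWeight y * polyFun p (x + r • y) ^ 2 :=
            hi _ (hc.pow 2)
          have i2 : Integrable fun y =>
              2 * polyFun p x * (capWeight y * polyFun p (x + r • y)) := (hi _ hc).const_mul _
          have i3 : Integrable fun y => capWeight y * polyFun p (x + r • y) ^ 2 -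
              2 * polyFun p x * (capWeight y * polyFun p (x + r • y)) := i1.sub i2
          rw [integral_add i3 (hcw.const_mul _), integral_sub i1 i2, integral_const_mul,
            integral_const_mul, hmean]
          ring
  set G : EuclideanSpace ℝ (Fin n) → ℝ :=
    (Metric.ball (0 : EuclideanSpace ℝ (Fin n)) (‖x‖ + r)).indicator fun X => polyFun p X ^ 2 with hG
  have hGi : Integrable G := by
    rw [hG, integrable_indicator_iff Metric.isOpen_ball.measurableSet]
    exact (((continuous_polyFun p).pow 2).continuousOn.integrableOn_compact
      (isCompact_closedBall 0 (‖x‖ + r))).mono_set Metric.ball_subset_closedBall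
  have hG0 (X : EuclideanSpace ℝ (Fin n)) : 0 ≤ G X := indicator_nonneg (fun _ _ => sq_nonneg _) X
  have h2 : ∫ y, capWeight y * polyFun p (x + r • y) ^ 2 ≤ ∫ y, G (x + r • y) := by
    refine integral_mono (hi _ (hc.pow 2)) ((hGi.comp_add_left x).comp_smul hr.ne') fun y => ?_
    by_cases hy : 1 ≤ ‖y‖
    · simp only [capWeight_eq_zero hy, zero_mul]
      exact hG0 _
    · have : x + r • y ∈ Metric.ball (0 : EuclideanSpace ℝ (Fin n)) (‖x‖ + r) := by
        rw [mem_ball_zero_iff]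
        refine (norm_add_le _ _).trans_lt ?_
        rw [norm_smul, Real.norm_of_nonneg hr.le]
        nlinarith
      simp only [hG, indicator_of_mem this]
      exact mul_le_of_le_one_left (sq_nonneg _) (capWeight_le_one y)
  have h3 : ∫ y, G (x + r • y) = (r ^ n)⁻¹ * ∫ X, G X := by
    rw [Measure.integral_comp_smul volume (fun y => G (x + y)) r, integral_add_left_eq_self,
      finrank_euclideanSpace_fin, abs_of_pos (by positivity), smul_eq_mul]
  rw [h3, hG, integral_indicator Metric.isOpen_ball.measurableSet] at h2
  linarith

/-- A spherical harmonic of degree `k` is bounded by a power of `k` times its `L²` norm. -/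
theorem exists_sq_polyFun_le (hn : 0 < n) : ∃ D : ℝ, 0 ≤ D ∧
    ∀ (k : ℕ) (p : MvPolynomial (Fin n) ℝ), p.IsHomogeneous k → polyLaplacian n p = 0 →
      ∀ x : UnitSphere n, polyFun p x.1 ^ 2 ≤
        D * ((k : ℝ) + 1) ^ n * ∫ w, polyFun p (w : UnitSphere n).1 ^ 2 ∂(surfaceMeasure n) := by
  set V := ∫ y : EuclideanSpace ℝ (Fin n), capWeight y with hV
  have hVpos : 0 < V := integral_capWeight_pos
  -- For `0 < t < 1 + r ≤ 2` with `r = 1/(k+1)`, one has `t^{n-1} ≤ 2^{n-1}` and `t^{2k} ≤ e^{2kr} ≤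
  -- e²`, on an interval of length at most `2`. This radius keeps the growth of `|X|^{2k}` bounded
  -- and costs only `r⁻ⁿ = (k+1)^n`.
  refine ⟨(2 ^ (n - 1) * Real.exp 2 * 2) / V, by positivity, fun k p hp hΔ x => ?_⟩
  have hk : (0 : ℝ) < (k : ℝ) + 1 := by positivity
  set r : ℝ := ((k : ℝ) + 1)⁻¹ with hr
  have hr0 : 0 < r := by positivity
  have hr1 : r ≤ 1 := inv_le_one_of_one_le₀ (by linarith [(k.cast_nonneg : (0 : ℝ) ≤ k)])
  have hx : ‖x.1‖ = 1 := norm_eq_of_mem_sphere x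
  have h1 := sq_polyFun_le_integral_ball hΔ x.1 hr0
  have hA : 0 ≤ ∫ w, polyFun p (w : UnitSphere n).1 ^ 2 ∂(surfaceMeasure n) :=
    integral_nonneg fun w => sq_nonneg _
  have h2 : ∫ X in Metric.ball (0 : EuclideanSpace ℝ (Fin n)) (‖x.1‖ + r), polyFun p X ^ 2 =
      (∫ t in Ioi (0 : ℝ), t ^ (n - 1) * (Iio (1 + r)).indicator (fun t => t ^ (2 * k)) t) *
        ∫ w, polyFun p (w : UnitSphere n).1 ^ 2 ∂(surfaceMeasure n) := by
    rw [← integral_indicator Metric.isOpen_ball.measurableSet]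
    refine integral_of_polar hn fun t ht w => ?_
    have hw : ‖t • w.1‖ = t := by
      rw [norm_smul, norm_eq_of_mem_sphere w, mul_one, Real.norm_of_nonneg ht.le]
    simp only [Set.indicator, mem_ball_zero_iff, hw, hx, mem_Iio, polyFun_smul hp]
    split_ifs
    · ring
    · simp
  have h3 : ∫ t in Ioi (0 : ℝ), t ^ (n - 1) * (Iio (1 + r)).indicator (fun t => t ^ (2 * k)) t ≤
      2 ^ (n - 1) * Real.exp 2 * 2 := by
    have e1 (t : ℝ) : t ^ (n - 1) * (Iio (1 + r)).indicator (fun t => t ^ (2 * k)) t =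
        (Iio (1 + r)).indicator (fun t => t ^ (n - 1) * t ^ (2 * k)) t := by
      simp only [Set.indicator]; split_ifs <;> simp
    simp_rw [e1]
    rw [setIntegral_indicator measurableSet_Iio, Ioi_inter_Iio]
    have hb : ∀ t ∈ Ioo (0 : ℝ) (1 + r), ‖t ^ (n - 1) * t ^ (2 * k)‖ ≤
        2 ^ (n - 1) * Real.exp 2 := by
      intro t ht
      have ht0 := ht.1.le
      rw [Real.norm_of_nonneg (by positivity)]
      have e2 : t ^ (n - 1) ≤ 2 ^ (n - 1) := pow_le_pow_left₀ ht0 (by linarith [ht.2]) _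
      have e3 : t ^ (2 * k) ≤ Real.exp 2 := by
        calc t ^ (2 * k) ≤ Real.exp r ^ (2 * k) := by
              refine pow_le_pow_left₀ ht0 ?_ _
              linarith [Real.add_one_le_exp r, ht.2]
          _ = Real.exp ((2 * k : ℕ) * r) := (Real.exp_nat_mul _ _).symm
          _ ≤ Real.exp 2 := by
              rw [Real.exp_le_exp, hr, ← div_eq_mul_inv, div_le_iff₀ hk]
              push_cast
              linarith
      gcongr
    have := norm_setIntegral_le_of_norm_le_const (μ := volume) (s := Ioo (0 : ℝ) (1 + r))
      measure_Ioo_lt_top hb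
    refine (le_abs_self _).trans (this.trans ?_)
    rw [measureReal_def, Real.volume_Ioo, ENNReal.toReal_ofReal (by linarith)]
    gcongr
    linarith
  have h4 : (r ^ n)⁻¹ = ((k : ℝ) + 1) ^ n := by rw [hr, inv_pow, inv_inv]
  rw [h2, h4] at h1
  rw [div_mul_eq_mul_div, div_mul_eq_mul_div, le_div_iff₀ hVpos]
  refine h1.trans ?_
  calc _ ≤ ((k : ℝ) + 1) ^ n * ((2 ^ (n - 1) * Real.exp 2 * 2) *
        ∫ w, polyFun p (w : UnitSphere n).1 ^ 2 ∂(surfaceMeasure n)) := by gcongr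
    _ = _ := by ring

end Polar

/-! ### Rapid decay of the projections of a smooth function -/

section Decay

open MvPolynomial

variable {n : ℕ}

/-- A smooth radial cutoff function supported in an annulus. -/
noncomputable def annulusCutoff (ψ : ContDiffBump (1 : ℝ)) (X : EuclideanSpace ℝ (Fin n)) : ℝ :=
  ψ (‖X‖ ^ 2)

theorem contDiff_annulusCutoff (ψ : ContDiffBump (1 : ℝ)) :
    ContDiff ℝ ∞ (annulusCutoff (n := n) ψ) :=
  ψ.contDiff.comp (contDiff_norm_sq ℝ)

theorem hasCompactSupport_annulusCutoff (ψ : ContDiffBump (1 : ℝ)) :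
    HasCompactSupport (annulusCutoff (n := n) ψ) := by
  refine HasCompactSupport.intro (isCompact_closedBall 0 (1 + ψ.rOut)) fun X hX => ?_
  have h1 : 1 + ψ.rOut < ‖X‖ := by simpa using hX
  have h2 := ψ.rOut_pos
  refine ψ.zero_of_le_dist ?_
  rw [Real.dist_eq]
  refine le_trans ?_ (le_abs_self _)
  nlinarith

theorem rot_annulusCutoff (ψ : ContDiffBump (1 : ℝ)) (i j : Fin n) :
    rot i j (annulusCutoff ψ) = 0 := by
  ext X
  have h1 : HasFDerivAt (fun X : EuclideanSpace ℝ (Fin n) => ‖X‖ ^ 2) (2 • innerSL ℝ X) X :=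
    (hasStrictFDerivAt_norm_sq X).hasFDerivAt
  have h2 : HasDerivAt ψ (deriv ψ (‖X‖ ^ 2)) (‖X‖ ^ 2) :=
    ((ψ.contDiff (n := 1)).differentiable one_ne_zero _).hasDerivAt
  have h3 : HasFDerivAt (annulusCutoff ψ) (deriv ψ (‖X‖ ^ 2) • (2 • innerSL ℝ X)) X :=
    h2.comp_hasFDerivAt X h1
  simp [rot, h3.fderiv, EuclideanSpace.inner_single_right]
  ring

theorem normalExtension_smul (u : UnitSphere n → ℝ) {c : ℝ} (hc : 0 < c)
    (X : EuclideanSpace ℝ (Fin n)) : normalExtension u (c • X) = normalExtension u X := by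
  by_cases hX : X = 0
  · simp [hX]
  · rw [normalExtension, normalExtension, dif_neg hX, dif_neg (smul_ne_zero hc.ne' hX)]
    congr 2
    rw [norm_smul, Real.norm_of_nonneg hc.le, smul_smul, mul_inv]
    congr 1
    field_simp

theorem normalExtension_coe (u : UnitSphere n → ℝ) (x : UnitSphere n) :
    normalExtension u x.1 = u x := by
  have hx : ‖x.1‖ = 1 := norm_eq_of_mem_sphere x
  have h0 : x.1 ≠ 0 := by rw [← norm_ne_zero_iff, hx]; exact one_ne_zero
  rw [normalExtension, dif_neg h0]
  congr 1
  ext1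
  simp [hx]

/-- The normal extension is constant on rays, so dilations carry its smoothness near the sphere to
every nonzero point. -/
theorem IsSmooth.contDiffAt {u : UnitSphere n → ℝ} (hu : IsSmooth u)
    {X : EuclideanSpace ℝ (Fin n)} (hX : X ≠ 0) : ContDiffAt ℝ ∞ (normalExtension u) X := by
  obtain ⟨U, hUo, hSU, hU⟩ := hu
  have hn : 0 < ‖X‖⁻¹ := inv_pos.2 (norm_pos_iff.2 hX)
  have hmem : ‖X‖⁻¹ • X ∈ U := hSU (by
    rw [mem_sphere_zero_iff_norm, norm_smul, norm_inv, norm_norm,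
      inv_mul_cancel₀ (norm_ne_zero_iff.mpr hX)])
  have h1 : ContDiffAt ℝ ∞ (normalExtension u) (‖X‖⁻¹ • X) := hU.contDiffAt (hUo.mem_nhds hmem)
  have h2 : ContDiffAt ℝ ∞ (fun Z => normalExtension u (‖X‖⁻¹ • Z)) X :=
    h1.comp X (contDiff_const_smul _).contDiffAt
  simpa only [normalExtension_smul u hn] using h2

theorem IsSmooth.continuous {u : UnitSphere n → ℝ} (hu : IsSmooth u) : Continuous u := by
  have : u = fun x : UnitSphere n => normalExtension u x.1 := by
    ext x; rw [normalExtension_coe]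
  rw [this, continuous_iff_continuousAt]
  intro x
  have hx : ‖x.1‖ = 1 := norm_eq_of_mem_sphere x
  have h0 : x.1 ≠ 0 := by rw [← norm_ne_zero_iff, hx]; exact one_ne_zero
  exact ContinuousAt.comp (hu.contDiffAt h0).continuousAt continuous_subtype_val.continuousAt

theorem contDiff_annulusCutoff_mul_normalExtension {u : UnitSphere n → ℝ} (hu : IsSmooth u)
    {ψ : ContDiffBump (1 : ℝ)} (hψ : ψ.rOut < 1) :
    ContDiff ℝ ∞ (annulusCutoff ψ * normalExtension u) := by
  rw [contDiff_iff_contDiffAt]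
  intro X
  by_cases hX : X = 0
  · subst hX
    refine (contDiffAt_const (c := (0 : ℝ))).congr_of_eventuallyEq ?_
    have hlt : ∀ᶠ X : EuclideanSpace ℝ (Fin n) in 𝓝 0, ‖X‖ ^ 2 < 1 - ψ.rOut := by
      have hc : Continuous fun X : EuclideanSpace ℝ (Fin n) => ‖X‖ ^ 2 := by fun_prop
      exact hc.continuousAt.eventually_lt continuousAt_const (by simpa using hψ)
    filter_upwards [hlt] with X hX
    have : annulusCutoff ψ X = 0 := by
      refine ψ.zero_of_le_dist ?_
      rw [Real.dist_eq, abs_sub_comm]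
      exact le_trans (by linarith) (le_abs_self _)
    simp [this]
  · exact (contDiff_annulusCutoff ψ).contDiffAt.mul (hu.contDiffAt hX)

instance : IsFiniteMeasure (surfaceMeasure n) := by
  unfold surfaceMeasure; infer_instance

/-- The Fourier coefficients of a smooth function decay faster than any power. -/
theorem exists_eigenvalue_pow_mul_integral_le (hn : 0 < n) {u : UnitSphere n → ℝ}
    (hu : IsSmooth u) (M : ℕ) : ∃ C : ℝ, 0 ≤ C ∧
    ∀ (k : ℕ) (p : MvPolynomial (Fin n) ℝ), p.IsHomogeneous k → polyLaplacian n p = 0 →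
      |2 * eigenvalue n k| ^ M * |∫ w, u w * polyFun p (w : UnitSphere n).1 ∂(surfaceMeasure n)| ≤
        C * ∫ w, |polyFun p (w : UnitSphere n).1| ∂(surfaceMeasure n) := by
  -- Two nested cutoffs, with `χ = 1` on the support of `ψ`. The outer one makes `G` smooth on all
  -- of `ℝⁿ`; the inner one stays outside the differential operator as a nonnegative radial weight.
  let ψ : ContDiffBump (1 : ℝ) := ⟨1 / 4, 1 / 2, by norm_num, by norm_num⟩
  let χ : ContDiffBump (1 : ℝ) := ⟨1 / 2, 3 / 4, by norm_num, by norm_num⟩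
  have hψχ (t : ℝ) : ψ t * χ t = ψ t := by
    by_cases ht : dist t 1 ≤ 1 / 2
    · rw [χ.one_of_mem_closedBall ht, mul_one]
    · rw [ψ.zero_of_le_dist (not_le.1 ht).le, zero_mul]
  set φ : EuclideanSpace ℝ (Fin n) → ℝ := annulusCutoff ψ with hφ
  set G : EuclideanSpace ℝ (Fin n) → ℝ := annulusCutoff χ * normalExtension u with hG
  have hφs : ContDiff ℝ ∞ φ := contDiff_annulusCutoff ψ
  have hφc : HasCompactSupport φ := hasCompactSupport_annulusCutoff ψ
  have hφ0 (X : EuclideanSpace ℝ (Fin n)) : 0 ≤ φ X := ψ.nonneg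
  have hGs : ContDiff ℝ ∞ G := contDiff_annulusCutoff_mul_normalExtension hu (by norm_num [χ])
  have hGc : HasCompactSupport G := (hasCompactSupport_annulusCutoff χ).mul_right
  have hφG (X : EuclideanSpace ℝ (Fin n)) : (φ * G) X = φ X * normalExtension u X := by
    simp only [hG, Pi.mul_apply, hφ, annulusCutoff, ← mul_assoc, hψχ]
  set H := rotLaplacian^[M] G with hH
  have hHs : ContDiff ℝ ∞ H := contDiff_iterate_rotLaplacian hGs M
  -- This bound involves only `u`, the cutoffs and `M`, hence is uniform in `k` and `p`.
  obtain ⟨C, hC⟩ := hHs.continuous.bounded_above_of_compact_support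
    (hasCompactSupport_iterate_rotLaplacian hGc M)
  have hC0 : 0 ≤ C := (norm_nonneg _).trans (hC 0)
  refine ⟨C, hC0, fun k p hp hΔ => ?_⟩
  have hnorm {r : ℝ} (hr : 0 < r) (w : UnitSphere n) : ‖r • w.1‖ = r := by
    rw [norm_smul, norm_eq_of_mem_sphere w, mul_one, Real.norm_of_nonneg hr.le]
  -- The radial moment depends on `k`, but the same factor appears on both sides of the estimate and
  -- cancels once it is known to be positive.
  set m : ℝ := ∫ r in Ioi (0 : ℝ), r ^ (n - 1) * (ψ (r ^ 2) * r ^ k) with hm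
  have hm0 : 0 ≤ m := setIntegral_nonneg measurableSet_Ioi fun r hr =>
    mul_nonneg (pow_nonneg (le_of_lt hr) _) (mul_nonneg ψ.nonneg (pow_nonneg (le_of_lt hr) _))
  have hmpos : 0 < m := by
    have h1 : ∫ X : EuclideanSpace ℝ (Fin n), φ X * ‖X‖ ^ k =
        m * ∫ _w : UnitSphere n, 1 ∂(surfaceMeasure n) :=
      integral_of_polar hn fun r hr w => by
        simp only [hφ, annulusCutoff, hnorm hr, mul_one]
    have h2 : 0 < ∫ X : EuclideanSpace ℝ (Fin n), φ X * ‖X‖ ^ k := by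
      have hv : ‖(stdVec ⟨0, hn⟩ : EuclideanSpace ℝ (Fin n))‖ = 1 := by simp
      refine (hφs.continuous.mul (by fun_prop)).integral_pos_of_hasCompactSupport_nonneg_nonzero
        hφc.mul_right (fun X => mul_nonneg (hφ0 X) (by positivity)) (x := stdVec ⟨0, hn⟩) ?_
      have h1 : ψ 1 = 1 := ψ.one_of_mem_closedBall (by simp [ψ.rIn_pos.le])
      simp [hφ, annulusCutoff, hv, h1]
    refine hm0.lt_of_ne fun h0 => ?_
    rw [h1, ← h0, zero_mul] at h2
    exact lt_irrefl _ h2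
  have hI1 : ∫ X, (φ * G) X * polyFun p X =
      m * ∫ w, u w * polyFun p (w : UnitSphere n).1 ∂(surfaceMeasure n) :=
    integral_of_polar hn fun r hr w => by
      rw [hφG, normalExtension_smul u hr, normalExtension_coe, polyFun_smul hp]
      simp only [hφ, annulusCutoff, hnorm hr]
      ring
  have hI2 : ∫ X, φ X * |polyFun p X| =
      m * ∫ w, |polyFun p (w : UnitSphere n).1| ∂(surfaceMeasure n) :=
    integral_of_polar hn fun r hr w => by
      rw [polyFun_smul hp, abs_mul, abs_of_nonneg (pow_nonneg hr.le _)]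
      simp only [hφ, annulusCutoff, hnorm hr]
      ring
  have hI3 := integral_iterate_rotLaplacian_mul_polyFun (f := φ * G) (hφs.mul hGs)
    hφc.mul_right hp hΔ M
  rw [iterate_rotLaplacian_mul hφs hGs (rot_annulusCutoff ψ) M] at hI3
  have hle : |∫ X, (φ * H) X * polyFun p X| ≤ C * ∫ X, φ X * |polyFun p X| := by
    rw [← integral_const_mul, ← Real.norm_eq_abs]
    refine norm_integral_le_of_norm_le ?_ (ae_of_all _ fun X => ?_)
    · exact ((hφs.continuous.mul (continuous_polyFun p).abs).integrable_of_hasCompactSupport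
        hφc.mul_right).const_mul C
    · rw [norm_mul, Pi.mul_apply, norm_mul, Real.norm_of_nonneg (hφ0 X),
        Real.norm_eq_abs (polyFun p X)]
      have := mul_le_mul_of_nonneg_left (hC X) (mul_nonneg (hφ0 X) (abs_nonneg (polyFun p X)))
      linarith
  rw [hI3, hI1, hI2, abs_mul, abs_mul, abs_of_pos hmpos, abs_pow, neg_mul, abs_neg] at hle
  refine le_of_mul_le_mul_left ?_ hmpos
  linarith

theorem restrictToSphere_apply (p : MvPolynomial (Fin n) ℝ) (w : UnitSphere n) :
    restrictToSphere n p w = polyFun p w.1 := by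
  simp only [restrictToSphere, polyFun, AlgHom.toLinearMap_apply]
  exact MvPolynomial.comp_aeval_apply _ (Pi.evalAlgHom ℝ (fun _ : UnitSphere n => ℝ) w) p

theorem continuous_of_mem_sphericalHarmonics {k : ℕ} {f : UnitSphere n → ℝ}
    (hf : f ∈ sphericalHarmonics n k) : Continuous f := by
  obtain ⟨p, -, rfl⟩ := hf
  have : restrictToSphere n p = fun w : UnitSphere n => polyFun p w.1 := by
    ext w; exact restrictToSphere_apply p w
  rw [this]
  exact (continuous_polyFun p).comp continuous_subtype_val

theorem integrable_surfaceMeasure {f : UnitSphere n → ℝ} (hf : Continuous f) :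
    Integrable f (surfaceMeasure n) :=
  hf.integrable_of_hasCompactSupport (HasCompactSupport.of_compactSpace f)

/-- The projection `P_k u(x)` is the integral of `u` against the zonal harmonic with pole `x`. -/
theorem exists_zonal {d : ℕ → ℕ} {Y : (k : ℕ) → Fin (d k) → UnitSphere n → ℝ}
    (hY : IsSphericalHarmonicBasis Y) {u : UnitSphere n → ℝ} (hu : Continuous u)
    (x : UnitSphere n) (k : ℕ) : ∃ p : MvPolynomial (Fin n) ℝ, p.IsHomogeneous k ∧
      polyLaplacian n p = 0 ∧
      proj Y k u x = ∫ w, u w * polyFun p (w : UnitSphere n).1 ∂(surfaceMeasure n) ∧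
      ∫ w, polyFun p (w : UnitSphere n).1 ^ 2 ∂(surfaceMeasure n) = polyFun p x.1 := by
  have hmem (l : Fin (d k)) : Y k l ∈ sphericalHarmonics n k := by
    rw [← hY.span_eq k]; exact Submodule.subset_span ⟨l, rfl⟩
  have hYc (l : Fin (d k)) : Continuous (Y k l) := continuous_of_mem_sphericalHarmonics (hmem l)
  have hZ : ∑ l, Y k l x • Y k l ∈ sphericalHarmonics n k :=
    Submodule.sum_mem _ fun l _ => Submodule.smul_mem _ _ (hmem l)
  obtain ⟨p, ⟨hp, hΔ⟩, hpZ⟩ := hZ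
  have hpw (w : UnitSphere n) : polyFun p w.1 = ∑ l, Y k l x * Y k l w := by
    rw [← restrictToSphere_apply, hpZ]; simp
  refine ⟨p, hp, hΔ, ?_, ?_⟩
  · simp_rw [hpw, Finset.mul_sum]
    have hi (l : Fin (d k)) : Integrable (fun w => u w * (Y k l x * Y k l w))
        (surfaceMeasure n) :=
      integrable_surfaceMeasure (hu.mul (continuous_const.mul (hYc l)))
    rw [integral_finsetSum _ fun l _ => hi l, proj]
    refine Finset.sum_congr rfl fun l _ => ?_
    rw [mul_comm, ← integral_const_mul]
    congr 1; ext w; ring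
  · simp_rw [hpw, sq, Finset.sum_mul_sum]
    have hi (l l' : Fin (d k)) : Integrable
        (fun w => Y k l x * Y k l w * (Y k l' x * Y k l' w)) (surfaceMeasure n) :=
      integrable_surfaceMeasure ((continuous_const.mul (hYc l)).mul (continuous_const.mul (hYc l')))
    rw [integral_finsetSum _ fun l _ => integrable_finsetSum _ fun l' _ => hi l l']
    refine Finset.sum_congr rfl fun l _ => ?_
    rw [integral_finsetSum _ fun l' _ => hi l l']
    have (l' : Fin (d k)) : ∫ w, Y k l x * Y k l w * (Y k l' x * Y k l' w) ∂(surfaceMeasure n) =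
        Y k l x * Y k l' x * if l = l' then 1 else 0 := by
      rw [← hY.orthonormal k l l', ← integral_const_mul]
      congr 1; ext w; ring
    simp [this]

/-- The projections of a smooth function onto the spaces of spherical harmonics decay rapidly. -/
theorem summable_proj (hn : 2 ≤ n) {d : ℕ → ℕ} {Y : (k : ℕ) → Fin (d k) → UnitSphere n → ℝ}
    (hY : IsSphericalHarmonicBasis Y) {u : UnitSphere n → ℝ} (hu : IsSmooth u)
    (x : UnitSphere n) : Summable fun k : ℕ => (1 + (k : ℝ) ^ 2) * |proj Y k u x| := by
  have hn0 : 0 < n := by omega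
  obtain ⟨D, hD0, hD⟩ := exists_sq_polyFun_le hn0
  -- Of the `n + 4` powers, `n` absorb the bound on the zonal harmonic, two the weight `1 + k²`, and
  -- two remain for convergence.
  obtain ⟨C, hC0, hC⟩ := exists_eigenvalue_pow_mul_integral_le hn0 hu (n + 4)
  set σ := (surfaceMeasure n).real univ with hσ
  have hσ0 : 0 ≤ σ := measureReal_nonneg
  have hsum : Summable fun k : ℕ => C * (σ * D) * (1 / ((k : ℝ) + 1) ^ 2) := by
    refine Summable.mul_left _ ?_
    have := (summable_nat_add_iff 1).2 (Real.summable_one_div_nat_pow.2 one_lt_two)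
    simpa using this
  -- The degree `0` is dropped because its eigenvalue is `0`; for `k ≥ 1`, `2 λ_k ≥ 2 k² ≥ k + 1`.
  rw [← summable_nat_add_iff 1] at hsum ⊢
  refine Summable.of_nonneg_of_le (fun k => by positivity) (fun j => ?_) hsum
  generalize hk : j + 1 = k
  have hk1 : (1 : ℝ) ≤ k := by rw [← hk]; push_cast; linarith [(j.cast_nonneg : (0 : ℝ) ≤ j)]
  obtain ⟨p, hp, hΔ, hproj, hsq⟩ := exists_zonal hY hu.continuous x k
  have hK : (0 : ℝ) < (k : ℝ) + 1 := by linarith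
  have hp0 : 0 ≤ polyFun p x.1 := by rw [← hsq]; exact integral_nonneg fun w => sq_nonneg _
  -- At the pole, `∫ p² = p(x)` turns the sup bound into `p(x)² ≤ D (k+1)^n p(x)`, and one factor
  -- `p(x)` cancels.
  have hpx : polyFun p x.1 ≤ D * ((k : ℝ) + 1) ^ n := by
    have h := hD k p hp hΔ x
    rw [hsq] at h
    rcases hp0.eq_or_lt with h0 | h0
    · rw [← h0]; positivity
    · rw [sq] at h
      exact le_of_mul_le_mul_right h h0
  have hpw (w : UnitSphere n) : |polyFun p w.1| ≤ D * ((k : ℝ) + 1) ^ n := by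
    refine abs_le_of_sq_le_sq ?_ (by positivity)
    have h := hD k p hp hΔ w
    rw [hsq] at h
    calc _ ≤ _ := h
      _ ≤ D * ((k : ℝ) + 1) ^ n * (D * ((k : ℝ) + 1) ^ n) := by gcongr
      _ = _ := (sq _).symm
  have hL1 : ∫ w, |polyFun p (w : UnitSphere n).1| ∂(surfaceMeasure n) ≤
      D * ((k : ℝ) + 1) ^ n * σ := by
    have h := norm_integral_le_of_norm_le_const (μ := surfaceMeasure n)
      (f := fun w : UnitSphere n => |polyFun p w.1|) (C := D * ((k : ℝ) + 1) ^ n)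
      (ae_of_all _ fun w => by simpa using hpw w)
    exact (le_abs_self _).trans h
  have hdec := hC k p hp hΔ
  rw [← hproj] at hdec
  have hlam : (k : ℝ) + 1 ≤ |2 * eigenvalue n k| := by
    refine le_trans ?_ (le_abs_self _)
    have : (2 : ℝ) ≤ n := by exact_mod_cast hn
    rw [eigenvalue]
    nlinarith [mul_nonneg (by linarith : (0 : ℝ) ≤ k) (by linarith : (0 : ℝ) ≤ (n : ℝ) - 2)]
  have hfin : ((k : ℝ) + 1) ^ (n + 4) * |proj Y k u x| ≤ C * (D * ((k : ℝ) + 1) ^ n * σ) :=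
    calc _ ≤ |2 * eigenvalue n k| ^ (n + 4) * |proj Y k u x| := by gcongr
      _ ≤ _ := hdec
      _ ≤ _ := by gcongr
  have hfin' : ((k : ℝ) + 1) ^ 4 * |proj Y k u x| ≤ C * (σ * D) := by
    refine le_of_mul_le_mul_left ?_ (pow_pos hK n)
    rw [pow_add] at hfin
    linarith
  rw [mul_one_div, le_div_iff₀ (by positivity)]
  refine le_trans ?_ hfin'
  have : (1 + (k : ℝ) ^ 2) * ((k : ℝ) + 1) ^ 2 ≤ ((k : ℝ) + 1) ^ 4 := by
    have : 1 + (k : ℝ) ^ 2 ≤ ((k : ℝ) + 1) ^ 2 := by nlinarith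
    calc _ ≤ ((k : ℝ) + 1) ^ 2 * ((k : ℝ) + 1) ^ 2 := by gcongr
      _ = _ := by ring
  calc _ = (1 + (k : ℝ) ^ 2) * ((k : ℝ) + 1) ^ 2 * |proj Y k u x| := by ring
    _ ≤ _ := by gcongr

end Decay

end SphereFrac

theorem theorem6p2 (n : ℕ) (hn : 2 ≤ n) (d : ℕ → ℕ)
    (Y : (k : ℕ) → Fin (d k) → SphereFrac.UnitSphere n → ℝ)
    (hY : SphereFrac.IsSphericalHarmonicBasis Y)
    (s : ℝ) (hs0 : 0 < s) (hs1 : s < 1)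
    (u : SphereFrac.UnitSphere n → ℝ) (hu : SphereFrac.IsSmooth u)
    (x : SphereFrac.UnitSphere n) :
    -- absolute convergence of the series and of the integral in the formula
    Summable (fun k : ℕ => SphereFrac.eigenvalue n k ^ s * SphereFrac.proj Y k u x) ∧
    Summable (fun k : ℕ => ((k : ℝ) + ((n : ℝ) - 2) / 2) ^ (2 * s) * SphereFrac.proj Y k u x) ∧
    (∀ t : ℝ, 0 ≤ t →
      Summable (fun k : ℕ => Real.exp (-t * (k : ℝ)) * SphereFrac.proj Y k u x)) ∧
    IntegrableOn (SphereFrac.remainderIntegrand Y s u x) (Ioi 0) ∧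
    -- the formula
    SphereFrac.fracLaplacian Y s u x =
      SphereFrac.fracDirichletToNeumann Y (2 * s) u x + SphereFrac.remainderOperator Y s u x :=
  SphereFrac.representation_of_summable n hn d Y s hs0 hs1 u x
    (SphereFrac.summable_proj hn hY hu x)
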